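/- Let $N\ge 1$, $\ell>0$, $s_1,\dots,s_N>0$, $\gamma\in\mathbb R\setminus\{0\}$, and let $v,v_b>0$ be fixed. Put $L=\sum_{i=1}^N(\ell+s_i)$ and consider the $L$-periodic chain on $\mathbb R$ whose unit cell consists of $N$ resonators of length $\ell$, the first one starting at $0$ and the $i$-th one being followed by a gap of length $s_i$; let $x_i^{\mathsf L}<x_i^{\mathsf R}$ denote the ends of the resonators and $D$ their union. For $\delta>0$ and real $\alpha$, call $\omega\in\mathbb C$ a resonant frequency if there is a non-zero continuous $u:\mathbb R\to\mathbb C$ with $$u''+\gamma u'+\tfrac{\omega^2}{v_b^2}u=0\ \text{ in } D,\qquad u''+\tfrac{\omega^2}{v^2}u=0\ \text{ in }\mathbb R\setminus\overline D,$$ such that at every end of every resonator the one-sided derivative of $u$ from inside the resonator equals $\delta$ times the one-sided derivative from outside, and $u(x+L)=e^{-\mathrm i\alpha L}u(x)$ for all $x$. A subwavelength eigenfrequency at $\alpha$ is a family $\omega(\delta)\to0$ $(\delta\to0^+)$ of resonant frequencies with non-negative real part; as functions of $\alpha$ in the Brillouin zone these families are the subwavelength band functions. With $s_0:=s_N$,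 let $C^{\gamma,\alpha}\in\mathbb C^{N\times N}$ be the quasiperiodic gauge capacitance matrix $$C^{\gamma,\alpha}_{ij}=\Big(\tfrac{\gamma}{s_i}\tfrac{\ell}{1-e^{-\gamma\ell}}-\tfrac{\gamma}{s_{i-1}}\tfrac{\ell}{1-e^{\gamma\ell}}\Big)\delta_{ij}-\tfrac{\gamma}{s_i}\tfrac{\ell}{1-e^{-\gamma\ell}}\delta_{i(j-1)}+\tfrac{\gamma}{s_j}\tfrac{\ell}{1-e^{\gamma\ell}}\delta_{i(j+1)}-e^{-\mathrm i\alpha L}\tfrac{\gamma}{s_N}\tfrac{\ell}{1-e^{-\gamma\ell}}\delta_{iN}\delta_{j1}+e^{\mathrm i\alpha L}\tfrac{\gamma}{s_N}\tfrac{\ell}{1-e^{\gamma\ell}}\delta_{i1}\delta_{jN},$$ and let $V=\operatorname{diag}(\ell,\dots,\ell)$. Then there are functions $\lambda_i^\alpha$ and $\omega_i^\alpha(\delta)$, $1\le i\le N$, such that for every $\alpha\in(-\pi/L,\pi/L]$ for which the eigenvalues of $C^{\gamma,\alpha}$ are simple the following holds. The numbers $\lambda_1^\alpha,\dots,\lambda_N^\alpha$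 are distinct and are precisely the eigenvalues of $C^{\gamma,\alpha}\boldsymbol a=\lambda V\boldsymbol a$. There are exactly $N$ subwavelength eigenfrequencies at $\alpha$, namely $\omega_1^\alpha,\dots,\omega_N^\alpha$: each $\omega_i^\alpha$ is one, they are pairwise distinct for all small $\delta>0$, and every subwavelength eigenfrequency at $\alpha$ takes, for all small $\delta>0$, its values in $\{\omega_1^\alpha(\delta),\dots,\omega_N^\alpha(\delta)\}$. For every $i$, $$\omega_i^\alpha(\delta)=v_b\sqrt{\delta\lambda_i^\alpha}+O(\delta)\qquad\text{as }\delta\to0^+,$$ where the principal square root is taken (with $\sqrt0=0$); it has positive real part for all $\delta>0$ if $\lambda_i^\alpha\neq0$. -/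

import Mathlib

open Filter Topology Asymptotics Set

noncomputable section

/-- Data of an infinite one-dimensional chain made of a unit cell of `N` resonators of common
length `len`, the `i`-th one being followed by a gap of length `gap i`, repeated periodically.
The resonators carry an imaginary gauge potential `gauge ≠ 0`; `vb` and `v` are the wave speeds
in the resonators and in the background. -/
structure PeriodicChain (N : ℕ) where
  len : ℝ
  gap : Fin N → ℝ
  gauge : ℝ
  vb : ℝ
  v : ℝ
  len_pos : 0 < len
  gap_pos : ∀ i, 0 < gap i
  gauge_ne_zero : gauge ≠ 0
  vb_pos : 0 < vb
  v_pos : 0 < v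

namespace PeriodicChain

variable {N : ℕ} (S : PeriodicChain N)

/-- The size `L` of the unit cell. -/
def period : ℝ := ∑ i, (S.len + S.gap i)

/-- Left end of the `i`-th resonator of the `m`-th cell; that of the first resonator of the
cell `m = 0` is the origin. -/
def leftEnd (m : ℤ) (i : Fin N) : ℝ := m * S.period + ∑ j ∈ Finset.Iio i, (S.len + S.gap j)

/-- Right end of the `i`-th resonator of the `m`-th cell. -/
def rightEnd (m : ℤ) (i : Fin N) : ℝ := S.leftEnd m i + S.len

/-- The union of all (open) resonators. -/
def resonators : Set ℝ := ⋃ (m : ℤ) (i : Fin N), Ioo (S.leftEnd m i) (S.rightEnd m i)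

/-- The union of all (open) gaps, i.e. the background medium: the `i`-th gap of a cell runs
from the right end of the `i`-th resonator to the left end of the next one. -/
def background : Set ℝ :=
  ⋃ (m : ℤ) (i : Fin N), Ioo (S.rightEnd m i) (S.rightEnd m i + S.gap i)

/-- The first Brillouin zone `(-π/L, π/L]`. -/
def brillouinZone : Set ℝ := Ioc (-(Real.pi / S.period)) (Real.pi / S.period)

/-- `u : ℝ → ℂ` solves the `α`-quasiperiodic scattering problem at frequency `ω` and contrast
`δ`. The Floquet phase is `exp (-iαL)` per cell. -/
structure IsBlochSolution (α δ : ℝ) (ω : ℂ) (u : ℝ → ℂ) : Prop where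
  continuous : Continuous u
  /-- `u'' + γ u' + (ω / v_b)² u = 0` in the resonators. -/
  inside : ∀ x ∈ S.resonators, DifferentiableAt ℝ u x ∧ DifferentiableAt ℝ (deriv u) x ∧
    deriv (deriv u) x + S.gauge * deriv u x + (ω / S.vb) ^ 2 * u x = 0
  /-- `u'' + (ω / v)² u = 0` in the background. -/
  outside : ∀ x ∈ S.background, DifferentiableAt ℝ u x ∧ DifferentiableAt ℝ (deriv u) x ∧
    deriv (deriv u) x + (ω / S.v) ^ 2 * u x = 0
  /-- At left ends, the derivative from inside is `δ` times the derivative from outside. -/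
  left_jump : ∀ m i, ∃ d : ℂ,
    HasDerivWithinAt u d (Iio (S.leftEnd m i)) (S.leftEnd m i) ∧
    HasDerivWithinAt u (δ * d) (Ioi (S.leftEnd m i)) (S.leftEnd m i)
  /-- At right ends, the derivative from inside is `δ` times the derivative from outside. -/
  right_jump : ∀ m i, ∃ d : ℂ,
    HasDerivWithinAt u d (Ioi (S.rightEnd m i)) (S.rightEnd m i) ∧
    HasDerivWithinAt u (δ * d) (Iio (S.rightEnd m i)) (S.rightEnd m i)
  quasiperiodic : ∀ x, u (x + S.period) = Complex.exp (-(Complex.I * α * S.period)) * u x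

/-- `ω` is a resonant frequency: the `α`-quasiperiodic problem has a non-zero solution. -/
def IsResonance (α δ : ℝ) (ω : ℂ) : Prop := ∃ u : ℝ → ℂ, u ≠ 0 ∧ S.IsBlochSolution α δ ω u

/-- `δ ↦ ω δ` is a subwavelength eigenfrequency at quasiperiodicity `α`: for small `δ > 0` it is
a resonant frequency with non-negative real part, and it tends to `0` as `δ → 0`. -/
def IsSubwavelength (α : ℝ) (ω : ℝ → ℂ) : Prop :=
  Tendsto ω (𝓝[>] 0) (𝓝 0) ∧ ∀ᶠ δ in 𝓝[>] (0 : ℝ), 0 ≤ (ω δ).re ∧ S.IsResonance α δ (ω δ)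

/-- The quasiperiodic gauge capacitance matrix. The subtraction in `i - 1 : Fin N` is modulo `N`,
so that the gap preceding the first resonator is the last one. -/
def qpCapacitance [NeZero N] (α : ℝ) : Matrix (Fin N) (Fin N) ℂ := fun i j =>
  let a : ℂ := S.len / (1 - Complex.exp (-(S.gauge * S.len)))
  let b : ℂ := S.len / (1 - Complex.exp (S.gauge * S.len))
  (if i = j then S.gauge / S.gap i * a - S.gauge / S.gap (i - 1) * b else 0)
  + (if (i : ℕ) + 1 = j then -(S.gauge / S.gap i * a) else 0)
  + (if (i : ℕ) = j + 1 then S.gauge / S.gap j * b else 0)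
  + (if (i : ℕ) + 1 = N ∧ (j : ℕ) = 0 then
      -(Complex.exp (-(Complex.I * α * S.period)) * (S.gauge / S.gap i) * a) else 0)
  + (if (i : ℕ) = 0 ∧ (j : ℕ) + 1 = N then
      Complex.exp (Complex.I * α * S.period) * (S.gauge / S.gap j) * b else 0)

/-- The volume matrix `diag (ℓ, …, ℓ)`. -/
def volumeMatrix : Matrix (Fin N) (Fin N) ℂ := Matrix.diagonal fun _ => (S.len : ℂ)

/-- All eigenvalues of the quasiperiodic gauge capacitance matrix are (algebraically) simple. -/
def HasSimpleEigenvalues [NeZero N] (α : ℝ) : Prop :=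
  ∀ μ : ℂ, (S.qpCapacitance α).charpoly.rootMultiplicity μ ≤ 1

/-- The eigenvalues of the generalised eigenvalue problem `C a = μ V a`. -/
def capacitanceEigenvalues [NeZero N] (α : ℝ) : Set ℂ :=
  {μ | ∃ a : Fin N → ℂ, a ≠ 0 ∧
    (S.qpCapacitance α).mulVec a = μ • S.volumeMatrix.mulVec a}

end PeriodicChain

/-- The principal square root; its real part is non-negative. -/
def principalSqrt (z : ℂ) : ℂ := z ^ (1 / 2 : ℂ)

end

/-! Carrying the pair (`u`, derivative of `u` taken from outside) across a resonator and the gap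
after it is a 2×2 transfer matrix. A frequency is therefore resonant exactly when the product `M` of
the `N` transfer matrices of a cell has the Floquet phase φ as an eigenvalue (`isResonance_iff`). By
Liouville's formula det `M` = exp(-Nγℓ), so this is one scalar equation, `charFun` = φ² - φ tr `M` +
exp(-Nγℓ) = 0.

The right variable is ζ = ω²/δ: in (δ, ζ) the equation is regular up to δ = 0. There `u` is constant
on resonators and affine on gaps, and the balance of the fluxes at a resonator is a row of the
capacitance eigenproblem. Hence every v_b²λ_i is a zero of `charFun` at δ = 0
(`charFun_eq_zero_of_eigenvalue`). That function is a non-zero polynomial in ζ of degree at most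
`N`, so `N` distinct eigenvalues account for all its zeros and make them simple
(`simple_zeros_charFun`).

The implicit function theorem then gives `N` branches ζ = ψ_i(δ). Compactness shows that they
contain all zeros with ζ bounded, and a homogeneity of the transfer matrices rules out zeros with ζ
large and ω small (`charFun_ne_zero_of_large`, `exists_branches`).

It remains to take ω = √(δψ_i(δ)). A Gershgorin estimate gives λ = 0 or Re λ > 0
(`eigenvalue_eq_zero_or_re_pos`). In the second case the root is differentiable near ψ_i(0) and Re ω
≥ 0 selects the principal one; in the first the branch vanishes identically near δ = 0
(`charFun_zero`). -/

noncomputable section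

/-! ### Fundamental solutions of the constant coefficient equation. -/

section FundamentalSolutions

open scoped Matrix.Norms.Operator

/-- The companion matrix of `u'' + g u' + κ u = 0`. -/
def companion (g κ : ℂ) : Matrix (Fin 2) (Fin 2) ℂ := !![0, 1; -κ, -g]

/-- The solution of `u'' + g u' + κ u = 0` with `u 0 = 1`, `u' 0 = 0`. -/
def cosSol (g κ : ℂ) (x : ℝ) : ℂ := NormedSpace.exp (x • companion g κ) 0 0

/-- The solution of `u'' + g u' + κ u = 0` with `u 0 = 0`, `u' 0 = 1`. -/
def sinSol (g κ : ℂ) (x : ℝ) : ℂ := NormedSpace.exp (x • companion g κ) 0 1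

@[simp] lemma cosSol_zero (g κ : ℂ) : cosSol g κ 0 = 1 := by
  simp [cosSol]

@[simp] lemma sinSol_zero (g κ : ℂ) : sinSol g κ 0 = 0 := by
  simp [sinSol]

lemma hasDerivAt_entry {f : ℝ → Matrix (Fin 2) (Fin 2) ℂ} {f' : Matrix (Fin 2) (Fin 2) ℂ} {x : ℝ}
    (h : HasDerivAt f f' x) (i j : Fin 2) : HasDerivAt (fun t => f t i j) (f' i j) x :=
  (LinearMap.toContinuousLinearMap (Matrix.entryLinearMap ℝ ℂ i j)).hasFDerivAt.comp_hasDerivAt x h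

lemma hasDerivAt_cosSol (g κ : ℂ) (x : ℝ) :
    HasDerivAt (cosSol g κ) (-κ * sinSol g κ x) x := by
  have h := hasDerivAt_entry (hasDerivAt_exp_smul_const (𝕂 := ℝ) (companion g κ) x) 0 0
  have e : (NormedSpace.exp (x • companion g κ) * companion g κ) 0 0 = -κ * sinSol g κ x := by
    rw [Matrix.mul_apply, Fin.sum_univ_two]
    simp only [companion, sinSol, Matrix.of_apply, Matrix.cons_val', Matrix.cons_val_zero,
      Matrix.cons_val_one, Matrix.cons_val_fin_one]
    ring
  exact e ▸ h

lemma hasDerivAt_sinSol (g κ : ℂ) (x : ℝ) :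
    HasDerivAt (sinSol g κ) (cosSol g κ x - g * sinSol g κ x) x := by
  have h := hasDerivAt_entry (hasDerivAt_exp_smul_const (𝕂 := ℝ) (companion g κ) x) 0 1
  have e : (NormedSpace.exp (x • companion g κ) * companion g κ) 0 1 =
      cosSol g κ x - g * sinSol g κ x := by
    rw [Matrix.mul_apply, Fin.sum_univ_two]
    simp only [companion, cosSol, sinSol, Matrix.of_apply, Matrix.cons_val', Matrix.cons_val_zero,
      Matrix.cons_val_one, Matrix.cons_val_fin_one]
    ring
  exact e ▸ h

/-- The companion matrix is affine in `κ` and the exponential is analytic. Building the solutions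
from the exponential avoids the root √κ, which is singular at `κ = 0`, the point where the analysis
takes place. -/
lemma contDiff_exp_companion (g : ℂ) (x : ℝ) (i j : Fin 2) :
    ContDiff ℂ 1 (fun κ => NormedSpace.exp (x • companion g κ) i j) := by
  have h1 : ContDiff ℂ 1 (NormedSpace.exp : Matrix (Fin 2) (Fin 2) ℂ → Matrix (Fin 2) (Fin 2) ℂ) :=
    contDiff_iff_contDiffAt.2 fun A => (NormedSpace.exp_analytic (𝕂 := ℂ) A).contDiffAt
  have h2 : ContDiff ℂ 1 (fun κ : ℂ => x • companion g κ) := by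
    have : (fun κ : ℂ => x • companion g κ) =
        fun κ : ℂ => x • companion g 0 + κ • (x • !![0, 0; -1, 0]) := by
      ext κ i j
      fin_cases i <;> fin_cases j <;> simp [companion]
      ring
    rw [this]
    fun_prop
  exact (LinearMap.toContinuousLinearMap (Matrix.entryLinearMap ℂ ℂ i j)).contDiff.comp
    (h1.comp h2)

lemma contDiff_cosSol (g : ℂ) (x : ℝ) : ContDiff ℂ 1 (fun κ => cosSol g κ x) :=
  contDiff_exp_companion g x 0 0

lemma contDiff_sinSol (g : ℂ) (x : ℝ) : ContDiff ℂ 1 (fun κ => sinSol g κ x) :=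
  contDiff_exp_companion g x 0 1

end FundamentalSolutions

lemma hasDerivAt_cexp_mul_real (g : ℂ) (x : ℝ) :
    HasDerivAt (fun x : ℝ => Complex.exp (g * x)) (g * Complex.exp (g * x)) x := by
  have h := ((Complex.ofRealCLM.hasDerivAt (x := x)).const_mul g).cexp
  simpa [mul_comm] using h

/-- Liouville's formula for the Wronskian. -/
lemma wronskian_cosSol_sinSol (g κ : ℂ) (x : ℝ) :
    Complex.exp (g * x) *
      (cosSol g κ x * (cosSol g κ x - g * sinSol g κ x) + κ * sinSol g κ x ^ 2) = 1 := by
  have hd : ∀ x : ℝ, HasDerivAt (fun x : ℝ => Complex.exp (g * x) *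
      (cosSol g κ x * (cosSol g κ x - g * sinSol g κ x) + κ * sinSol g κ x ^ 2)) 0 x := by
    intro x
    have hc := hasDerivAt_cosSol g κ x
    have hs := hasDerivAt_sinSol g κ x
    have h := (hasDerivAt_cexp_mul_real g x).mul
      ((hc.mul (hc.sub (hs.const_mul g))).add ((hs.pow 2).const_mul κ))
    refine h.congr_deriv ?_
    simp only [Pi.mul_apply, Pi.sub_apply, Pi.add_apply, Pi.pow_apply]
    push_cast
    ring
  have := is_const_of_deriv_eq_zero (fun x => (hd x).differentiableAt) (fun x => (hd x).deriv) x 0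
  simpa using this

@[simp] lemma cosSol_kappa_zero (g : ℂ) (x : ℝ) : cosSol g 0 x = 1 := by
  have hd : ∀ x : ℝ, HasDerivAt (cosSol g 0) 0 x := by
    intro x
    simpa using hasDerivAt_cosSol g 0 x
  have := is_const_of_deriv_eq_zero (fun x => (hd x).differentiableAt) (fun x => (hd x).deriv) x 0
  simpa using this

lemma sinSol_kappa_zero {g : ℂ} (hg : g ≠ 0) (x : ℝ) :
    sinSol g 0 x = (1 - Complex.exp (-(g * x))) / g := by
  have h := wronskian_cosSol_sinSol g 0 x
  simp only [cosSol_kappa_zero] at h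
  rw [Complex.exp_neg]
  field_simp
  linear_combination -h

@[simp] lemma sinSol_zero_zero (x : ℝ) : sinSol 0 0 x = x := by
  have hd : ∀ x : ℝ, HasDerivAt (fun x : ℝ => sinSol 0 0 x - x) 0 x := by
    intro x
    refine ((hasDerivAt_sinSol 0 0 x).sub (Complex.ofRealCLM.hasDerivAt (x := x))).congr_deriv ?_
    simp
  have := is_const_of_deriv_eq_zero (fun x => (hd x).differentiableAt) (fun x => (hd x).deriv) x 0
  simpa [sub_eq_zero] using this

/-! ### Transfer matrices and the characteristic function. -/

namespace PeriodicChain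

variable {N : ℕ} (S : PeriodicChain N)

/-- The Floquet phase per cell. -/
def phase (α : ℝ) : ℂ := Complex.exp (-(Complex.I * α * S.period))

/-- The determinant of the transfer matrix of one resonator. -/
def decay : ℂ := Complex.exp (-(S.gauge * S.len))

lemma phase_ne_zero (α : ℝ) : S.phase α ≠ 0 := Complex.exp_ne_zero _

lemma norm_phase (α : ℝ) : ‖S.phase α‖ = 1 := by
  rw [phase, Complex.norm_exp]
  simp

lemma phase_inv (α : ℝ) : (S.phase α)⁻¹ = Complex.exp (Complex.I * α * S.period) := by
  rw [phase, Complex.exp_neg, inv_inv]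

lemma decay_eq_ofReal : S.decay = (Real.exp (-(S.gauge * S.len)) : ℝ) := by
  simp [decay]

lemma gauge_ne_zero' : (S.gauge : ℂ) ≠ 0 := by exact_mod_cast S.gauge_ne_zero

lemma vb_ne_zero' : (S.vb : ℂ) ≠ 0 := by exact_mod_cast S.vb_pos.ne'

lemma len_ne_zero' : (S.len : ℂ) ≠ 0 := by exact_mod_cast S.len_pos.ne'

lemma decay_ne_zero : S.decay ≠ 0 := Complex.exp_ne_zero _

lemma decay_ne_one : S.decay ≠ 1 := by
  rw [decay_eq_ofReal]
  have : Real.exp (-(S.gauge * S.len)) ≠ 1 := by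
    rw [Ne, Real.exp_eq_one_iff, neg_eq_zero]
    exact mul_ne_zero S.gauge_ne_zero S.len_pos.ne'
  exact_mod_cast this

/-- Transfer matrix of a resonator, in the state `(u, u')` with the derivative taken from outside.
The physical values of the arguments are `η = 1`, `x = ω² / δ`, `y = δ`, `z = ω²`. -/
def resonatorMatrix (η x y z : ℂ) : Matrix (Fin 2) (Fin 2) ℂ :=
  !![η * cosSol S.gauge (z / S.vb ^ 2) S.len, y * sinSol S.gauge (z / S.vb ^ 2) S.len;
    -(x / S.vb ^ 2) * sinSol S.gauge (z / S.vb ^ 2) S.len,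
    η * (cosSol S.gauge (z / S.vb ^ 2) S.len - S.gauge * sinSol S.gauge (z / S.vb ^ 2) S.len)]

/-- Transfer matrix of a gap of length `s` at `z = ω²`. -/
def gapMatrix (s : ℝ) (z : ℂ) : Matrix (Fin 2) (Fin 2) ℂ :=
  !![cosSol 0 (z / S.v ^ 2) s, sinSol 0 (z / S.v ^ 2) s;
    -(z / S.v ^ 2) * sinSol 0 (z / S.v ^ 2) s, cosSol 0 (z / S.v ^ 2) s]

/-- Transfer matrix of a resonator followed by a gap of length `s`. -/
def cellMatrix (s : ℝ) (η x y z : ℂ) : Matrix (Fin 2) (Fin 2) ℂ :=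
  S.gapMatrix s z * S.resonatorMatrix η x y z

/-- Liouville's formula. The hypothesis is the homogeneous form of (ω²/δ)·δ = ω². -/
lemma det_resonatorMatrix {η x y z : ℂ} (h : x * y = η ^ 2 * z) :
    (S.resonatorMatrix η x y z).det = η ^ 2 * S.decay := by
  have hw := wronskian_cosSol_sinSol S.gauge (z / S.vb ^ 2) S.len
  rw [resonatorMatrix, Matrix.det_fin_two_of, decay, Complex.exp_neg]
  have hv := S.vb_ne_zero'
  set c := cosSol S.gauge (z / S.vb ^ 2) S.len
  set s := sinSol S.gauge (z / S.vb ^ 2) S.len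
  rw [← eq_inv_of_mul_eq_one_right hw]
  linear_combination (s ^ 2 / (S.vb : ℂ) ^ 2) * h

lemma det_gapMatrix (s : ℝ) (z : ℂ) : (S.gapMatrix s z).det = 1 := by
  have hw := wronskian_cosSol_sinSol 0 (z / S.v ^ 2) s
  simp only [zero_mul, Complex.exp_zero, one_mul, sub_zero] at hw
  rw [gapMatrix, Matrix.det_fin_two_of]
  linear_combination hw

/-- The reason for treating `η`, `x`, `y` as independent variables: this homogeneity allows division
by a large ζ = ω²/δ, so that ζ = ∞ becomes the regular point (0, 1, 0, 0). -/
lemma cellMatrix_smul (s : ℝ) (c η x y z : ℂ) :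
    S.cellMatrix s (c * η) (c * x) (c * y) z = c • S.cellMatrix s η x y z := by
  rw [cellMatrix, cellMatrix, ← Matrix.mul_smul]
  congr 1
  ext i j
  fin_cases i <;> fin_cases j <;> simp [resonatorMatrix] <;> ring

/-- The value at `κ = 0` of the solution vanishing at the left end of a resonator, at the right
end. -/
def sinLen : ℂ := (1 - S.decay) / S.gauge

lemma sinLen_ne_zero : S.sinLen ≠ 0 :=
  div_ne_zero (sub_ne_zero.2 S.decay_ne_one.symm) S.gauge_ne_zero'

lemma cellMatrix_z_zero (s : ℝ) (η x y : ℂ) : S.cellMatrix s η x y 0 =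
    !![1, (s : ℂ); 0, 1] *
      !![η, y * S.sinLen; -(x / S.vb ^ 2) * S.sinLen, η * S.decay] := by
  have hg := S.gauge_ne_zero'
  have h1 : sinSol S.gauge 0 S.len = S.sinLen := by
    rw [sinSol_kappa_zero hg, sinLen, decay]
  have h2 : 1 - S.gauge * S.sinLen = S.decay := by
    rw [sinLen]
    field_simp
    ring
  simp [cellMatrix, gapMatrix, resonatorMatrix, h1, h2]

lemma cellMatrix_leading (s : ℝ) : S.cellMatrix s 0 1 0 0 =
    !![-(s * S.sinLen / S.vb ^ 2), 0; -(S.sinLen / S.vb ^ 2), 0] := by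
  rw [cellMatrix_z_zero]
  ext i j
  fin_cases i <;> fin_cases j <;> simp [Matrix.mul_apply] <;> ring

lemma mul_add_ediv (m : ℤ) (i : Fin N) : (m * N + i) / (N : ℤ) = m := by
  have := i.2
  rw [add_comm, Int.add_mul_ediv_right _ _ (by omega), Int.ediv_eq_zero_of_lt (by omega) (by omega)]
  simp

variable [NeZero N]

/-- The position in its cell of the `k`-th resonator of the chain. -/
def cellIndex (N : ℕ) [NeZero N] (k : ℤ) : Fin N :=
  ⟨(k % N).toNat, by have := NeZero.pos N; have := Int.emod_lt_of_pos k (b := N) (by omega); omega⟩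

/-- The length of the gap following the `k`-th resonator of the chain. -/
def gapAt (k : ℤ) : ℝ := S.gap (cellIndex N k)

lemma coe_cellIndex (k : ℤ) : ((cellIndex N k : ℕ) : ℤ) = k % N := by
  have := NeZero.pos N
  have := Int.emod_nonneg k (b := N) (by omega)
  simp [cellIndex, this]

lemma cellIndex_add_card (k : ℤ) : cellIndex N (k + N) = cellIndex N k := by
  simp [cellIndex]

lemma cellIndex_mul_add (m : ℤ) (i : Fin N) : cellIndex N (m * N + i) = i := by
  have := i.2
  ext
  zify
  rw [coe_cellIndex, Int.mul_add_emod_self_right]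
  exact Int.emod_eq_of_lt (by omega) (by omega)

lemma ediv_mul_add_cellIndex (k : ℤ) : k / N * N + cellIndex N k = k := by
  rw [coe_cellIndex, mul_comm, Int.mul_ediv_add_emod]

lemma cellIndex_natCast (i : Fin N) : cellIndex N (i : ℕ) = i := by
  simpa using cellIndex_mul_add 0 i

lemma gapAt_add_card (k : ℤ) : S.gapAt (k + N) = S.gapAt k := by
  rw [gapAt, cellIndex_add_card, gapAt]

lemma gapAt_pos (k : ℤ) : 0 < S.gapAt k := S.gap_pos _

/-- Transfer matrix of the first `n` cells of the chain. -/
def chainMatrix : ℕ → ℂ → ℂ → ℂ → ℂ → Matrix (Fin 2) (Fin 2) ℂ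
  | 0, _, _, _, _ => 1
  | n + 1, η, x, y, z => S.cellMatrix (S.gapAt n) η x y z * chainMatrix n η x y z

lemma det_chainMatrix {η x y z : ℂ} (h : x * y = η ^ 2 * z) (n : ℕ) :
    (S.chainMatrix n η x y z).det = (η ^ 2 * S.decay) ^ n := by
  induction n with
  | zero => simp [chainMatrix]
  | succ n ih =>
    rw [chainMatrix, Matrix.det_mul, ih, cellMatrix, Matrix.det_mul, det_gapMatrix,
      S.det_resonatorMatrix h, pow_succ]
    ring

lemma chainMatrix_smul (n : ℕ) (c η x y z : ℂ) :
    S.chainMatrix n (c * η) (c * x) (c * y) z = c ^ n • S.chainMatrix n η x y z := by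
  induction n with
  | zero => simp [chainMatrix]
  | succ n ih =>
    rw [chainMatrix, chainMatrix, ih, cellMatrix_smul, Matrix.smul_mul, Matrix.mul_smul, smul_smul,
      pow_succ']

lemma eq_chainMatrix_mulVec {η x y z : ℂ} {X : ℤ → Fin 2 → ℂ} {m : ℕ}
    (hX : ∀ n : ℕ, n < m → X (n + 1) = (S.cellMatrix (S.gapAt n) η x y z).mulVec (X n)) :
    ∀ n : ℕ, n ≤ m → X n = (S.chainMatrix n η x y z).mulVec (X 0) := by
  intro n hn
  induction n with
  | zero => simp [chainMatrix]
  | succ n ih =>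
    push_cast
    rw [hX n hn, ih (by omega), chainMatrix, Matrix.mulVec_mulVec]

/-- Every factor has zero second column, so the trace of the product is the product of the upper
left entries, none of which vanishes. This trace is the coefficient of ζ^N in tr `M` at δ = 0. -/
lemma trace_chainMatrix_leading_ne_zero : (S.chainMatrix N 0 1 0 0).trace ≠ 0 := by
  have key : ∀ n : ℕ, S.chainMatrix n 0 1 0 0 0 0 ≠ 0 ∧ S.chainMatrix n 0 1 0 0 0 1 = 0 ∧
      (0 < n → S.chainMatrix n 0 1 0 0 1 1 = 0) := by
    intro n
    induction n with
    | zero => simp [chainMatrix]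
    | succ n ih =>
      obtain ⟨h1, h2, -⟩ := ih
      rw [chainMatrix, cellMatrix_leading]
      have hs : (S.gapAt n : ℂ) ≠ 0 := by exact_mod_cast (S.gapAt_pos n).ne'
      simp [Matrix.mul_apply, h1, h2, S.sinLen_ne_zero, S.vb_ne_zero', hs]
  obtain ⟨h1, -, h3⟩ := key N
  rw [Matrix.trace_fin_two, h3 (NeZero.pos N), add_zero]
  exact h1

/-- At ω = 0 all factors are upper triangular with diagonal (1, `decay`), whatever `y` is. -/
lemma trace_chainMatrix_zero (y : ℂ) (n : ℕ) :
    (S.chainMatrix n 1 0 y 0).trace = 1 + S.decay ^ n := by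
  have key : S.chainMatrix n 1 0 y 0 0 0 = 1 ∧ S.chainMatrix n 1 0 y 0 1 0 = 0 ∧
      S.chainMatrix n 1 0 y 0 1 1 = S.decay ^ n := by
    induction n with
    | zero => simp [chainMatrix]
    | succ n ih =>
      obtain ⟨h1, h2, h3⟩ := ih
      rw [chainMatrix, cellMatrix_z_zero]
      simp [Matrix.mul_apply, h1, h2, h3, pow_succ']
  rw [Matrix.trace_fin_two, key.1, key.2.2]

open Polynomial in
-- At `y = z = 0` each factor is affine in ζ, namely `A + ζ • B` with `B` the leading matrix.
lemma exists_polynomial_chainMatrix (n : ℕ) (i j : Fin 2) : ∃ p : ℂ[X], p.natDegree ≤ n ∧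
    p.coeff n = S.chainMatrix n 0 1 0 0 i j ∧
    ∀ ζ, p.eval ζ = S.chainMatrix n 1 ζ 0 0 i j := by
  induction n generalizing i j with
  | zero =>
    refine ⟨C ((1 : Matrix (Fin 2) (Fin 2) ℂ) i j), by simp, by simp [chainMatrix],
      by simp [chainMatrix]⟩
  | succ n ih =>
    choose p hp1 hp2 hp3 using ih
    let A := S.cellMatrix (S.gapAt n) 1 0 0 0
    let B := S.cellMatrix (S.gapAt n) 0 1 0 0
    have hAB : ∀ ζ, S.cellMatrix (S.gapAt n) 1 ζ 0 0 = A + ζ • B := by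
      intro ζ
      simp only [A, B, cellMatrix_z_zero]
      ext i j
      fin_cases i <;> fin_cases j <;> simp [Matrix.mul_apply] <;> ring
    refine ⟨∑ k, (C (A i k) + C (B i k) * X) * p k j, ?_, ?_, ?_⟩
    · refine natDegree_sum_le_of_forall_le _ _ fun k _ => ?_
      refine natDegree_mul_le.trans ?_
      have := hp1 k j
      have : (C (A i k) + C (B i k) * X).natDegree ≤ 1 := by
        rw [add_comm]; exact natDegree_linear_le
      omega
    · rw [chainMatrix, Matrix.mul_apply, finsetSum_coeff]
      refine Finset.sum_congr rfl fun k _ => ?_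
      have h0 : (p k j).coeff (n + 1) = 0 :=
        coeff_eq_zero_of_natDegree_lt (by have := hp1 k j; omega)
      rw [add_mul, mul_assoc, coeff_add, coeff_C_mul, coeff_C_mul, coeff_X_mul, h0, hp2]
      simp [B]
    · intro ζ
      rw [chainMatrix, hAB, Matrix.mul_apply, eval_finsetSum]
      refine Finset.sum_congr rfl fun k _ => ?_
      simp [hp3]
      left
      ring

/-- The characteristic function of the quasiperiodic problem, in the variables `ζ = ω² / δ`
and `δ`. -/
def charFun (α : ℝ) (ζ δ : ℂ) : ℂ :=
  S.phase α ^ 2 - S.phase α * (S.chainMatrix N 1 ζ δ (ζ * δ)).trace + S.decay ^ N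

/-- `charFun` is the characteristic polynomial of the cell's transfer matrix at the Floquet phase,
with the determinant already evaluated. -/
lemma charFun_eq_zero_iff (α : ℝ) (ζ δ : ℂ) : S.charFun α ζ δ = 0 ↔
    ∃ V : Fin 2 → ℂ, V ≠ 0 ∧
      (S.chainMatrix N 1 ζ δ (ζ * δ)).mulVec V = S.phase α • V := by
  have hdet : (S.chainMatrix N 1 ζ δ (ζ * δ) - S.phase α • (1 : Matrix (Fin 2) (Fin 2) ℂ)).det =
      S.charFun α ζ δ := by
    have h := S.det_chainMatrix (η := 1) (x := ζ) (y := δ) (z := ζ * δ) (by ring) N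
    rw [one_pow, one_mul] at h
    rw [charFun, ← h, Matrix.det_fin_two, Matrix.det_fin_two, Matrix.trace_fin_two]
    simp
    ring
  rw [← hdet, ← Matrix.exists_mulVec_eq_zero_iff]
  simp only [Matrix.sub_mulVec, Matrix.smul_mulVec, Matrix.one_mulVec, sub_eq_zero]

/-- Forces the branch through a zero eigenvalue to be identically zero for small contrast. -/
lemma charFun_zero (α : ℝ) (δ δ' : ℂ) : S.charFun α 0 δ = S.charFun α 0 δ' := by
  simp [charFun, trace_chainMatrix_zero]

open Polynomial in
lemma exists_polynomial_charFun (α : ℝ) : ∃ p : ℂ[X], p ≠ 0 ∧ p.natDegree ≤ N ∧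
    ∀ ζ, p.eval ζ = S.charFun α ζ 0 := by
  choose p hp1 hp2 hp3 using S.exists_polynomial_chainMatrix N
  refine ⟨C (S.phase α ^ 2 + S.decay ^ N) - C (S.phase α) * (p 0 0 + p 1 1), ?_, ?_, ?_⟩
  · intro h
    have h1 := congrArg (fun q => q.coeff N) h
    have hN := NeZero.ne N
    simp only [coeff_sub, coeff_C_mul, coeff_add, hp2, coeff_zero, coeff_C_of_ne_zero hN] at h1
    rw [← Matrix.trace_fin_two] at h1
    have := mul_ne_zero (S.phase_ne_zero α) S.trace_chainMatrix_leading_ne_zero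
    apply this
    linear_combination -h1
  · refine (natDegree_sub_le _ _).trans (max_le (by rw [natDegree_C]; omega) ?_)
    refine (natDegree_C_mul_le _ _).trans ((natDegree_add_le _ _).trans (max_le (hp1 _ _) (hp1 _ _)))
  · intro ζ
    simp [charFun, Matrix.trace_fin_two, hp3]
    ring

end PeriodicChain

/-! ### The capacitance matrix and its relation to zero contrast. -/

namespace PeriodicChain

variable {N : ℕ} (S : PeriodicChain N) [NeZero N]

/-- The quasiperiodic extension of a vector to a sequence indexed by all resonators. -/
def blochExtend (α : ℝ) (a : Fin N → ℂ) (k : ℤ) : ℂ := S.phase α ^ (k / N) * a (cellIndex N k)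

lemma blochExtend_add_card (α : ℝ) (a : Fin N → ℂ) (k : ℤ) :
    S.blochExtend α a (k + N) = S.phase α * S.blochExtend α a k := by
  have := NeZero.ne N
  rw [blochExtend, blochExtend, cellIndex_add_card,
    Int.add_ediv_of_dvd_right (dvd_refl _), Int.ediv_self (by omega),
    zpow_add₀ (S.phase_ne_zero α), zpow_one]
  ring

lemma blochExtend_natCast (α : ℝ) (a : Fin N → ℂ) (i : Fin N) :
    S.blochExtend α a (i : ℕ) = a i := by
  have := i.2
  rw [blochExtend, cellIndex_natCast, Int.ediv_eq_zero_of_lt (by omega) (by omega)]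
  simp

lemma norm_blochExtend (α : ℝ) (a : Fin N → ℂ) (k : ℤ) :
    ‖S.blochExtend α a k‖ = ‖a (cellIndex N k)‖ := by
  rw [blochExtend, norm_mul, norm_zpow, norm_phase, one_zpow, one_mul]

/-- The coupling of the `k`-th resonator to the next one. -/
def couplingRight (k : ℤ) : ℝ := S.gauge / S.gapAt k * (S.len / (1 - Real.exp (-(S.gauge * S.len))))

/-- The coupling of the `k`-th resonator to the previous one. -/
def couplingLeft (k : ℤ) : ℝ :=
  -(S.gauge / S.gapAt (k - 1) * (S.len / (1 - Real.exp (S.gauge * S.len))))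

lemma div_one_sub_exp_pos {x : ℝ} (hx : x ≠ 0) : 0 < x / (1 - Real.exp (-x)) := by
  rcases hx.lt_or_gt with h | h
  · exact div_pos_of_neg_of_neg h (by have := Real.one_lt_exp_iff.2 (neg_pos.2 h); linarith)
  · exact div_pos h (by have := Real.exp_lt_one_iff.2 (neg_lt_zero.2 h); linarith)

lemma couplingRight_pos (k : ℤ) : 0 < S.couplingRight k := by
  have h := div_one_sub_exp_pos (mul_ne_zero S.gauge_ne_zero S.len_pos.ne')
  have := div_pos h (S.gapAt_pos k)
  calc _ < _ := this
    _ = _ := by rw [couplingRight]; ring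

lemma couplingLeft_pos (k : ℤ) : 0 < S.couplingLeft k := by
  have h := div_one_sub_exp_pos (neg_ne_zero.2 (mul_ne_zero S.gauge_ne_zero S.len_pos.ne'))
  have := div_pos h (S.gapAt_pos (k - 1))
  calc _ < _ := this
    _ = _ := by rw [couplingLeft, neg_neg]; ring

lemma cellIndex_natCast_sub_one (i : Fin N) : cellIndex N ((i : ℕ) - 1 : ℤ) = i - 1 := by
  have hi := i.2
  rcases Nat.lt_or_ge N 2 with h | h
  · obtain rfl : N = 1 := by have := NeZero.ne N; omega
    exact Subsingleton.elim _ _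
  · ext
    zify
    rw [coe_cellIndex, Fin.val_sub, Fin.val_one', Nat.mod_eq_of_lt (by omega : 1 < N)]
    push_cast
    rw [Nat.cast_sub (by omega), ← Int.add_emod_right]
    congr 1
    push_cast
    ring

/-- The corner entries carry the phase that the quasiperiodic extension gains across a cell
boundary, so all rows become the same nearest-neighbour difference operator. -/
lemma qpCapacitance_mulVec (α : ℝ) (a : Fin N → ℂ) (i : Fin N) :
    (S.qpCapacitance α).mulVec a i =
      S.couplingRight i * (a i - S.blochExtend α a (i + 1)) +
      S.couplingLeft i * (a i - S.blochExtend α a (i - 1)) := by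
  have hN := NeZero.pos N
  have hi := i.2
  have hg : S.gapAt i = S.gap i := by
    have := cellIndex_natCast i
    rw [gapAt]; exact congrArg _ this
  have hg' : S.gapAt (i - 1) = S.gap (i - 1) := by
    rw [gapAt]; exact congrArg _ (cellIndex_natCast_sub_one i)
  -- Each off-diagonal entry is paired with its corner entry: for a given row exactly one of the two
  -- conditions can occur, according to whether the neighbour lies in the same cell. This also
  -- covers `N = 1` and `N = 2`, where several conditions hit the same matrix entry.
  have hR : ∀ t : ℂ, ∑ j : Fin N, ((if (i : ℕ) + 1 = j then -(S.gauge / S.gap i * t) else 0)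
      + (if (i : ℕ) + 1 = N ∧ (j : ℕ) = 0 then
        -(S.phase α * (S.gauge / S.gap i) * t) else 0)) * a j =
      -(S.gauge / S.gap i * t) * S.blochExtend α a (i + 1) := by
    intro t
    by_cases h : (i : ℕ) + 1 = N
    · have e : ((i : ℕ) + 1 : ℤ) = ((0 : Fin N) : ℕ) + N := by simp; omega
      rw [e, blochExtend_add_card, blochExtend_natCast, Finset.sum_eq_single (0 : Fin N)]
      · simp [h, hN.ne']; ring
      · intro j _ hj
        have : (j : ℕ) ≠ 0 := fun h => hj (Fin.ext (by simpa using h))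
        have := j.2
        rw [if_neg (by omega), if_neg (by omega)]
        simp
      · simp
    · have e : ((i : ℕ) + 1 : ℤ) = ((⟨i + 1, by omega⟩ : Fin N) : ℕ) := by simp
      rw [e, blochExtend_natCast, Finset.sum_eq_single (⟨i + 1, by omega⟩ : Fin N)]
      · simp
      · intro j _ hj
        have : (i : ℕ) + 1 ≠ j := fun h => hj (Fin.ext h.symm)
        rw [if_neg this, if_neg (by omega)]
        simp
      · simp
  have hL : ∀ t : ℂ, ∑ j : Fin N, ((if (i : ℕ) = j + 1 then S.gauge / S.gap j * t else 0)
      + (if (i : ℕ) = 0 ∧ (j : ℕ) + 1 = N then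
        (S.phase α)⁻¹ * (S.gauge / S.gap j) * t else 0)) * a j =
      (S.gauge / S.gap (i - 1) * t) * S.blochExtend α a (i - 1) := by
    intro t
    rw [← cellIndex_natCast_sub_one i]
    by_cases h : (i : ℕ) = 0
    · have h0 : S.blochExtend α a (i - 1) = (S.phase α)⁻¹ * a ⟨N - 1, by omega⟩ := by
        rw [← blochExtend_natCast S α a, eq_inv_mul_iff_mul_eq₀ (S.phase_ne_zero α),
          ← blochExtend_add_card]
        congr 1
        simp; omega
      have h1 : cellIndex N ((i : ℕ) - 1 : ℤ) = ⟨N - 1, by omega⟩ := by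
        rw [← cellIndex_natCast (⟨N - 1, by omega⟩ : Fin N), ← cellIndex_add_card]
        congr 1
        simp; omega
      rw [h0, h1, Finset.sum_eq_single (⟨N - 1, by omega⟩ : Fin N)]
      · simp [h, Nat.sub_add_cancel hN, hN.ne]; ring
      · intro j _ hj
        have : (j : ℕ) ≠ N - 1 := fun h => hj (Fin.ext h)
        rw [if_neg (by omega), if_neg (by omega)]
        simp
      · simp
    · have e : ((i : ℕ) - 1 : ℤ) = ((⟨i - 1, by omega⟩ : Fin N) : ℕ) := by simp; omega
      rw [e, blochExtend_natCast, cellIndex_natCast,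
        Finset.sum_eq_single (⟨i - 1, by omega⟩ : Fin N)]
      · have : (i : ℕ) = i - 1 + 1 := by omega
        simp [h, ← this]
      · intro j _ hj
        have : (j : ℕ) ≠ i - 1 := fun h => hj (Fin.ext h)
        rw [if_neg (by omega), if_neg (by omega)]
        simp
      · simp
  have hR' := hR (S.len / (1 - Complex.exp (-(S.gauge * S.len))))
  have hL' := hL (S.len / (1 - Complex.exp (S.gauge * S.len)))
  simp only [couplingRight, couplingLeft, hg, hg']
  push_cast
  rw [Matrix.mulVec, dotProduct]
  have hph : Complex.exp (-(Complex.I * α * S.period)) = S.phase α := rfl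
  simp only [qpCapacitance, ← phase_inv, hph]
  have hD : ∀ t : ℂ, ∑ j, (if i = j then t else 0) * a j = t * a i := by
    intro t; simp
  trans ((S.gauge / S.gap i * (S.len / (1 - Complex.exp (-(S.gauge * S.len)))) -
    S.gauge / S.gap (i - 1) * (S.len / (1 - Complex.exp (S.gauge * S.len)))) * a i) +
    -(S.gauge / S.gap i * (S.len / (1 - Complex.exp (-(S.gauge * S.len))))) *
      S.blochExtend α a (i + 1) +
    (S.gauge / S.gap (i - 1) * (S.len / (1 - Complex.exp (S.gauge * S.len)))) *
      S.blochExtend α a (i - 1)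
  · rw [← hR', ← hL', ← hD, ← Finset.sum_add_distrib, ← Finset.sum_add_distrib]
    refine Finset.sum_congr rfl fun j _ => ?_
    ring
  · ring

/-- Gershgorin's argument in the row where |a_i| is largest. The couplings are positive and the
phase has modulus one, so μℓ lies in the disc of centre and radius `p + q`, which meets the closed
left half-plane only at 0. -/
lemma eigenvalue_eq_zero_or_re_pos {α : ℝ} {μ : ℂ} (h : μ ∈ S.capacitanceEigenvalues α) :
    μ = 0 ∨ 0 < μ.re := by
  obtain ⟨a, ha, hC⟩ := h
  obtain ⟨i, -, hi⟩ := Finset.exists_max_image Finset.univ (fun j => ‖a j‖)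
    ⟨(0 : Fin N), Finset.mem_univ _⟩
  have hai : 0 < ‖a i‖ := by
    obtain ⟨j, hj⟩ := Function.ne_iff.1 ha
    exact (norm_pos_iff.2 hj).trans_le (hi j (Finset.mem_univ _))
  have hrow := congrFun hC i
  rw [qpCapacitance_mulVec, Pi.smul_apply, volumeMatrix, Matrix.mulVec_diagonal, smul_eq_mul] at hrow
  have hp := S.couplingRight_pos i
  have hq := S.couplingLeft_pos i
  set p := S.couplingRight i
  set q := S.couplingLeft i
  have hb : ‖((p + q : ℝ) : ℂ) - μ * S.len‖ * ‖a i‖ ≤ (p + q) * ‖a i‖ := by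
    rw [← norm_mul]
    have : (((p + q : ℝ) : ℂ) - μ * S.len) * a i =
        p * S.blochExtend α a (i + 1) + q * S.blochExtend α a (i - 1) := by
      push_cast; linear_combination hrow
    rw [this]
    refine (norm_add_le _ _).trans ?_
    rw [norm_mul, norm_mul, norm_blochExtend, norm_blochExtend, Complex.norm_real,
      Complex.norm_real, Real.norm_of_nonneg hp.le, Real.norm_of_nonneg hq.le, add_mul]
    gcongr <;> exact hi _ (Finset.mem_univ _)
  have hb := le_of_mul_le_mul_right hb hai
  have hb2 := pow_le_pow_left₀ (norm_nonneg _) hb 2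
  rw [← Complex.normSq_eq_norm_sq, Complex.normSq_apply] at hb2
  simp only [Complex.sub_re, Complex.ofReal_re, Complex.mul_re, Complex.ofReal_im, mul_zero,
    sub_zero, Complex.sub_im, Complex.mul_im, zero_add, zero_sub] at hb2
  have hl := S.len_pos
  by_contra! hcon
  obtain ⟨h0, h1⟩ := hcon
  have h2 : μ.re * S.len ≤ 0 := mul_nonpos_of_nonpos_of_nonneg h1 hl.le
  have h3 : (p + q) * (μ.re * S.len) ≤ 0 := mul_nonpos_of_nonneg_of_nonpos (by linarith) h2
  have h4 : (μ.re * S.len) ^ 2 + (μ.im * S.len) ^ 2 ≤ 0 := by nlinarith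
  have h5 : μ.re * S.len = 0 := by nlinarith [sq_nonneg (μ.re * S.len), sq_nonneg (μ.im * S.len)]
  have h6 : μ.im * S.len = 0 := by nlinarith [sq_nonneg (μ.re * S.len), sq_nonneg (μ.im * S.len)]
  exact h0 (Complex.ext (by simpa [hl.ne'] using h5) (by simpa [hl.ne'] using h6))

lemma charFun_eq_zero_of_eigenvalue {α : ℝ} {μ : ℂ} (h : μ ∈ S.capacitanceEigenvalues α) :
    S.charFun α (S.vb ^ 2 * μ) 0 = 0 := by
  obtain ⟨a, ha, hC⟩ := h
  let A := S.blochExtend α a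
  -- The limiting state: the constant value on the `k`-th resonator and the slope in the gap before
  -- it.
  let X : ℤ → Fin 2 → ℂ := fun k => ![A k, (A k - A (k - 1)) / S.gapAt (k - 1)]
  have hX : ∀ n : ℕ, n < N →
      X (n + 1) = (S.cellMatrix (S.gapAt n) 1 (S.vb ^ 2 * μ) 0 0).mulVec (X n) := by
    intro n hn
    have hrow := congrFun hC ⟨n, hn⟩
    rw [qpCapacitance_mulVec, Pi.smul_apply, volumeMatrix, Matrix.mulVec_diagonal, smul_eq_mul,
      ← blochExtend_natCast S α a] at hrow
    simp only [couplingRight, couplingLeft] at hrow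
    push_cast at hrow
    have hs : (S.gapAt n : ℂ) ≠ 0 := by exact_mod_cast (S.gapAt_pos n).ne'
    have hs' : (S.gapAt (n - 1) : ℂ) ≠ 0 := by exact_mod_cast (S.gapAt_pos (n - 1)).ne'
    have hE : Complex.exp (S.gauge * S.len) = S.decay⁻¹ := by
      rw [decay, Complex.exp_neg, inv_inv]
    rw [hE, ← decay] at hrow
    have hE0 := S.decay_ne_zero
    have hE1 : 1 - S.decay ≠ 0 := sub_ne_zero.2 S.decay_ne_one.symm
    have hE2 : 1 - S.decay⁻¹ ≠ 0 := by
      rw [sub_ne_zero]; intro h; exact S.decay_ne_one (by rw [← inv_inv S.decay, ← h, inv_one])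
    have hl := S.len_ne_zero'
    have hg := S.gauge_ne_zero'
    have hv := S.vb_ne_zero'
    -- Row `n` of the eigenproblem solved for the slope behind the resonator; this is the second row
    -- of the resonator matrix at zero contrast.
    have hflux : (A (n + 1) - A n) / S.gapAt n =
        -μ * S.sinLen * A n + S.decay * ((A n - A (n - 1)) / S.gapAt (n - 1)) := by
      have h1 : (S.gauge : ℂ) / S.gapAt (n - 1) * (S.len / (1 - S.decay⁻¹)) =
        - (S.gauge / S.gapAt (n - 1) * S.len * (S.decay / (1 - S.decay))) := by
        have : 1 - S.decay⁻¹ = -((1 - S.decay) / S.decay) := by field_simp; ring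
        rw [this]
        field_simp
      rw [h1, neg_neg] at hrow
      rw [sinLen]
      simp only [A]
      field_simp at hrow ⊢
      linear_combination -hrow
    rw [cellMatrix_z_zero, Matrix.mulVec_fin_two]
    simp only [X, add_sub_cancel_right]
    rw [hflux]
    ext i
    fin_cases i
    · simp [Matrix.mul_apply]
      field_simp at hflux ⊢
      linear_combination hflux
    · simp [Matrix.mul_apply, hv]
  have hchain := S.eq_chainMatrix_mulVec hX
  rw [charFun_eq_zero_iff]
  refine ⟨X 0, ?_, ?_⟩
  · intro h0
    apply ha
    ext i
    have h1 := hchain i i.2.le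
    rw [h0, Matrix.mulVec_zero] at h1
    have h2 := congrFun h1 0
    simpa [X, A, blochExtend_natCast] using h2
  · rw [mul_zero, ← hchain N le_rfl]
    have hA : ∀ k : ℤ, A (k + N) = S.phase α * A k := S.blochExtend_add_card α a
    have e1 : A N = S.phase α * A 0 := by simpa using hA 0
    have e2 : A (N - 1) = S.phase α * A (-1) := by rw [← hA]; congr 1
    have e3 : S.gapAt (N - 1) = S.gapAt (-1) := by
      rw [← S.gapAt_add_card (-1)]; congr 1
    ext i
    fin_cases i
    · simp [X, e1]
    · simp [X, e1, e2, e3]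
      ring

end PeriodicChain

/-! ### Solutions of the equation on an interval. -/

/-- The solution of `u'' + g u' + κ u = 0` with `u a = P`, `u' a = Q`. -/
def linSol (g κ : ℂ) (a : ℝ) (P Q : ℂ) (x : ℝ) : ℂ :=
  P * cosSol g κ (x - a) + Q * sinSol g κ (x - a)

@[simp] lemma linSol_self (g κ : ℂ) (a : ℝ) (P Q : ℂ) : linSol g κ a P Q a = P := by
  simp [linSol]

lemma linSol_add (g κ : ℂ) (a t : ℝ) (P Q : ℂ) (x : ℝ) :
    linSol g κ (a + t) P Q (x + t) = linSol g κ a P Q x := by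
  simp [linSol]

lemma linSol_mul (g κ : ℂ) (a : ℝ) (c P Q : ℂ) (x : ℝ) :
    linSol g κ a (c * P) (c * Q) x = c * linSol g κ a P Q x := by
  simp [linSol]
  ring

lemma hasDerivAt_linSol (g κ : ℂ) (a : ℝ) (P Q : ℂ) (x : ℝ) :
    HasDerivAt (linSol g κ a P Q) (linSol g κ a Q (-κ * P - g * Q) x) x := by
  have hc := (hasDerivAt_cosSol g κ (x - a)).comp_sub_const x a
  have hs := (hasDerivAt_sinSol g κ (x - a)).comp_sub_const x a
  refine ((hc.const_mul P).add (hs.const_mul Q)).congr_deriv ?_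
  simp only [linSol]
  ring

lemma linSol_ode_of_eventuallyEq {u : ℝ → ℂ} {g κ : ℂ} {a : ℝ} {P Q : ℂ} {x : ℝ}
    (h : u =ᶠ[𝓝 x] linSol g κ a P Q) : DifferentiableAt ℝ u x ∧ DifferentiableAt ℝ (deriv u) x ∧
      deriv (deriv u) x + g * deriv u x + κ * u x = 0 := by
  have h1 : deriv (linSol g κ a P Q) = linSol g κ a Q (-κ * P - g * Q) :=
    funext fun t => (hasDerivAt_linSol g κ a P Q t).deriv
  have h2 := h.deriv
  rw [h1] at h2
  refine ⟨((hasDerivAt_linSol g κ a P Q x).congr_of_eventuallyEq h).differentiableAt,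
    ((hasDerivAt_linSol g κ a _ _ x).congr_of_eventuallyEq h2).differentiableAt, ?_⟩
  rw [h2.deriv_eq, h2.eq_of_nhds, h.eq_of_nhds, (hasDerivAt_linSol g κ a _ _ x).deriv]
  simp only [linSol]
  ring

/-- Variation of constants: the weighted Wronskians `W₁`, `W₂` of `u` with the fundamental solutions
are constant, and Liouville's formula recovers `u` from them. Continuity extends the identity to the
end points. -/
lemma exists_eq_linSol {u : ℝ → ℂ} {g κ : ℂ} {a b : ℝ} (hab : a < b) (hu : ContinuousOn u (Icc a b))
    (hode : ∀ x ∈ Ioo a b, DifferentiableAt ℝ u x ∧ DifferentiableAt ℝ (deriv u) x ∧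
      deriv (deriv u) x + g * deriv u x + κ * u x = 0) :
    ∃ P Q : ℂ, ∀ x ∈ Icc a b, u x = linSol g κ a P Q x := by
  let E : ℝ → ℂ := fun x => Complex.exp (g * (x - a : ℝ))
  let c : ℝ → ℂ := fun x => cosSol g κ (x - a)
  let s : ℝ → ℂ := fun x => sinSol g κ (x - a)
  have hE : ∀ x, HasDerivAt E (g * E x) x := fun x =>
    (hasDerivAt_cexp_mul_real g (x - a)).comp_sub_const x a
  have hc : ∀ x, HasDerivAt c (-κ * s x) x := fun x =>
    (hasDerivAt_cosSol g κ (x - a)).comp_sub_const x a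
  have hs : ∀ x, HasDerivAt s (c x - g * s x) x := fun x =>
    (hasDerivAt_sinSol g κ (x - a)).comp_sub_const x a
  have hW : ∀ x, E x * (c x * (c x - g * s x) + κ * s x ^ 2) = 1 := fun x =>
    wronskian_cosSol_sinSol g κ (x - a)
  let W₁ : ℝ → ℂ := fun x => E x * (u x * (c x - g * s x) - deriv u x * s x)
  let W₂ : ℝ → ℂ := fun x => E x * (c x * deriv u x + κ * s x * u x)
  have hW₁ : ∀ x ∈ Ioo a b, HasDerivAt W₁ 0 x := by
    intro x hx
    obtain ⟨h1, h2, h3⟩ := hode x hx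
    refine ((hE x).mul ((h1.hasDerivAt.mul ((hc x).sub ((hs x).const_mul g))).sub
      (h2.hasDerivAt.mul (hs x)))).congr_deriv ?_
    simp only [Pi.mul_apply, Pi.sub_apply]
    linear_combination (-E x * s x) * h3
  have hW₂ : ∀ x ∈ Ioo a b, HasDerivAt W₂ 0 x := by
    intro x hx
    obtain ⟨h1, h2, h3⟩ := hode x hx
    refine ((hE x).mul (((hc x).mul h2.hasDerivAt).add
      (((hs x).const_mul κ).mul h1.hasDerivAt))).congr_deriv ?_
    simp only [Pi.mul_apply, Pi.add_apply]
    linear_combination (E x * c x) * h3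
  have hconst : ∀ W : ℝ → ℂ, (∀ x ∈ Ioo a b, HasDerivAt W 0 x) →
      ∃ P, ∀ x ∈ Ioo a b, W x = P := fun W h =>
    isOpen_Ioo.exists_is_const_of_deriv_eq_zero isPreconnected_Ioo
      (fun x hx => (h x hx).differentiableAt.differentiableWithinAt) (fun x hx => (h x hx).deriv)
  obtain ⟨P, hP⟩ := hconst W₁ hW₁
  obtain ⟨Q, hQ⟩ := hconst W₂ hW₂
  refine ⟨P, Q, ?_⟩
  have hIoo : EqOn u (linSol g κ a P Q) (Ioo a b) := by
    intro x hx
    rw [linSol, ← hP x hx, ← hQ x hx]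
    simp only [W₁, W₂]
    linear_combination (-u x) * hW x
  exact hIoo.of_subset_closure hu
    (fun x _ => (hasDerivAt_linSol g κ a P Q x).continuousAt.continuousWithinAt)
    Ioo_subset_Icc_self (closure_Ioo hab.ne).ge

lemma eq_linSol_of_hasDerivWithinAt {u : ℝ → ℂ} {g κ d e : ℂ} {a b : ℝ} (hab : a < b)
    (hu : ContinuousOn u (Icc a b))
    (hode : ∀ x ∈ Ioo a b, DifferentiableAt ℝ u x ∧ DifferentiableAt ℝ (deriv u) x ∧
      deriv (deriv u) x + g * deriv u x + κ * u x = 0)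
    (hd : HasDerivWithinAt u d (Ioi a) a) (he : HasDerivWithinAt u e (Iio b) b) :
    (∀ x ∈ Icc a b, u x = linSol g κ a (u a) d x) ∧
      e = linSol g κ a d (-κ * u a - g * d) b := by
  obtain ⟨P, Q, h⟩ := exists_eq_linSol hab hu hode
  have ha := h a (left_mem_Icc.2 hab.le)
  rw [linSol_self] at ha
  subst ha
  have h1 : HasDerivWithinAt u Q (Ioi a) a := by
    refine ((hasDerivAt_linSol g κ a (u a) Q a).hasDerivWithinAt.congr_of_eventuallyEq ?_
      (by simp)).congr_deriv (by simp)
    filter_upwards [Ioc_mem_nhdsGT hab] with x hx using h x (Ioc_subset_Icc_self hx)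
  have hQ : d = Q := (uniqueDiffWithinAt_Ioi a).eq_deriv _ hd h1
  subst hQ
  refine ⟨h, ?_⟩
  have h2 : HasDerivWithinAt u (linSol g κ a d (-κ * u a - g * d) b) (Iio b) b := by
    refine (hasDerivAt_linSol g κ a (u a) d b).hasDerivWithinAt.congr_of_eventuallyEq ?_
      (h b (right_mem_Icc.2 hab.le))
    filter_upwards [Ico_mem_nhdsLT hab] with x hx using h x (Ico_subset_Icc_self hx)
  exact (uniqueDiffWithinAt_Iio b).eq_deriv _ he h2

/-! ### The chain with its resonators numbered by the integers. -/

namespace PeriodicChain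

variable {N : ℕ} (S : PeriodicChain N) [NeZero N]

/-- The left end of the `k`-th resonator of the chain. -/
def node (k : ℤ) : ℝ := S.leftEnd (k / N) (cellIndex N k)

lemma leftEnd_eq_node (m : ℤ) (i : Fin N) : S.leftEnd m i = S.node (m * N + i) := by
  rw [node, mul_add_ediv, cellIndex_mul_add]

lemma gap_eq_gapAt (m : ℤ) (i : Fin N) : S.gap i = S.gapAt (m * N + i) := by
  rw [gapAt, cellIndex_mul_add]

lemma node_succ (k : ℤ) : S.node (k + 1) = S.node k + S.len + S.gapAt k := by
  have hN := NeZero.pos N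
  obtain ⟨m, i, rfl⟩ : ∃ (m : ℤ) (i : Fin N), m * N + i = k :=
    ⟨_, _, ediv_mul_add_cellIndex k⟩
  have hi := i.2
  rw [← leftEnd_eq_node, ← gap_eq_gapAt]
  by_cases h : (i : ℕ) + 1 < N
  · have e : m * N + i + 1 = m * N + ((⟨i + 1, h⟩ : Fin N) : ℕ) := by push_cast; ring
    rw [e, ← leftEnd_eq_node, leftEnd, leftEnd]
    have : Finset.Iio (⟨i + 1, h⟩ : Fin N) = insert i (Finset.Iio i) := by
      ext j
      simp [Fin.lt_def]
    rw [this, Finset.sum_insert (by simp)]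
    ring
  · have e : m * N + i + 1 = (m + 1) * N + ((0 : Fin N) : ℕ) := by
      have : ((i : ℕ) : ℤ) + 1 = N := by omega
      simp
      linear_combination this
    rw [e, ← leftEnd_eq_node, leftEnd, leftEnd, period]
    have h0 : Finset.Iio (0 : Fin N) = ∅ := by
      ext j; simp
    have : (Finset.univ : Finset (Fin N)) = insert i (Finset.Iio i) := by
      ext j
      have := j.2
      simp only [Finset.mem_univ, Finset.mem_insert, Finset.mem_Iio, Fin.lt_def, Fin.ext_iff,
        true_iff]
      omega
    rw [h0, Finset.sum_empty, this, Finset.sum_insert (by simp)]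
    push_cast
    ring

lemma node_add_card (k : ℤ) : S.node (k + N) = S.node k + S.period := by
  have := NeZero.ne N
  rw [node, node, cellIndex_add_card, Int.add_ediv_of_dvd_right (dvd_refl _),
    Int.ediv_self (by omega), leftEnd, leftEnd]
  push_cast
  ring

lemma node_strictMono : StrictMono S.node := by
  refine strictMono_int_of_lt_succ fun k => ?_
  rw [node_succ]
  linarith [S.len_pos, S.gapAt_pos k]

lemma node_lower_bound (k : ℤ) (n : ℕ) : S.node k + n * S.len ≤ S.node (k + n) := by
  induction n with
  | zero => simp
  | succ n ih =>
    have e : k + ((n + 1 : ℕ) : ℤ) = k + n + 1 := by push_cast; ring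
    rw [e, node_succ]
    push_cast
    linarith [S.len_pos, S.gapAt_pos (k + n)]

lemma exists_node_le_lt (x : ℝ) : ∃ k : ℤ, S.node k ≤ x ∧ x < S.node (k + 1) := by
  have hup : ∀ t : ℝ, ∃ n : ℕ, t ≤ n * S.len := fun t => by
    obtain ⟨n, hn⟩ := exists_nat_ge (t / S.len)
    exact ⟨n, (div_le_iff₀ S.len_pos).1 hn⟩
  obtain ⟨n, hn⟩ := hup (x - S.node 0)
  obtain ⟨m, hm⟩ := hup (S.node 0 - x)
  have h1 := S.node_lower_bound 0 n
  have h2 := S.node_lower_bound (-m) m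
  rw [neg_add_cancel] at h2
  obtain ⟨k, hk, hmax⟩ := Int.exists_greatest_of_bdd (P := fun k => S.node k ≤ x)
    ⟨(0 : ℤ) + n, fun k hk => S.node_strictMono.le_iff_le.1 (hk.trans (by linarith))⟩
    ⟨-m, by linarith⟩
  exact ⟨k, hk, not_le.1 fun h => by have := hmax _ h; omega⟩

lemma eq_of_mem_Ico_node {x : ℝ} {j k : ℤ} (hj : S.node j ≤ x ∧ x < S.node (j + 1))
    (hk : S.node k ≤ x ∧ x < S.node (k + 1)) : j = k := by
  have h1 := S.node_strictMono.lt_iff_lt.1 (hj.1.trans_lt hk.2)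
  have h2 := S.node_strictMono.lt_iff_lt.1 (hk.1.trans_lt hj.2)
  omega

lemma mem_resonators_iff {x : ℝ} :
    x ∈ S.resonators ↔ ∃ k, x ∈ Ioo (S.node k) (S.node k + S.len) := by
  simp only [resonators, mem_iUnion, rightEnd, leftEnd_eq_node]
  exact ⟨fun ⟨m, i, h⟩ => ⟨_, h⟩, fun ⟨k, h⟩ => ⟨k / N, cellIndex N k, by
    rwa [ediv_mul_add_cellIndex]⟩⟩

lemma mem_background_iff {x : ℝ} :
    x ∈ S.background ↔ ∃ k, x ∈ Ioo (S.node k + S.len) (S.node (k + 1)) := by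
  simp only [background, mem_iUnion, rightEnd, leftEnd_eq_node, node_succ]
  constructor
  · rintro ⟨m, i, h⟩
    exact ⟨m * N + i, by rwa [← gap_eq_gapAt]⟩
  · rintro ⟨k, h⟩
    exact ⟨k / N, cellIndex N k, by
      rwa [gap_eq_gapAt S (k / N) (cellIndex N k), ediv_mul_add_cellIndex]⟩

end PeriodicChain

/-! ### Resonances are the zeros of the characteristic function. -/

namespace PeriodicChain

variable {N : ℕ} (S : PeriodicChain N)

lemma resonatorMatrix_mulVec {δ : ℝ} (hδ : δ ≠ 0) (ω : ℂ) (a : ℝ) (V : Fin 2 → ℂ) :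
    (S.resonatorMatrix 1 (ω ^ 2 / δ) δ (ω ^ 2)).mulVec V =
      ![linSol S.gauge ((ω / S.vb) ^ 2) a (V 0) (δ * V 1) (a + S.len),
        linSol S.gauge ((ω / S.vb) ^ 2) a (δ * V 1)
          (-((ω / S.vb) ^ 2) * V 0 - S.gauge * (δ * V 1)) (a + S.len) / δ] := by
  have hδ' : (δ : ℂ) ≠ 0 := by exact_mod_cast hδ
  have hv := S.vb_ne_zero'
  rw [Matrix.mulVec_fin_two]
  simp only [linSol, add_sub_cancel_left, div_pow]
  ext i
  fin_cases i
  · simp [resonatorMatrix]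
    ring
  · simp [resonatorMatrix]
    field_simp
    ring

lemma gapMatrix_mulVec (s : ℝ) (ω : ℂ) (a : ℝ) (V : Fin 2 → ℂ) :
    (S.gapMatrix s (ω ^ 2)).mulVec V =
      ![linSol 0 ((ω / S.v) ^ 2) a (V 0) (V 1) (a + s),
        linSol 0 ((ω / S.v) ^ 2) a (V 1) (-((ω / S.v) ^ 2) * V 0 - 0 * V 1) (a + s)] := by
  rw [Matrix.mulVec_fin_two]
  simp only [linSol, add_sub_cancel_left, div_pow]
  ext i
  fin_cases i <;> simp [gapMatrix] <;> ring

variable [NeZero N] {S}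

/-- The states of a Bloch solution at the resonators, and its values in terms of them. -/
lemma IsBlochSolution.exists_states {α δ : ℝ} {ω : ℂ} {u : ℝ → ℂ} (hδ : δ ≠ 0)
    (hu : S.IsBlochSolution α δ ω u) : ∃ X : ℤ → Fin 2 → ℂ,
      (∀ k, X (k + N) = S.phase α • X k) ∧
      (∀ k, X (k + 1) = (S.cellMatrix (S.gapAt k) 1 (ω ^ 2 / δ) δ (ω ^ 2)).mulVec (X k)) ∧
      ∀ k, X k = 0 → ∀ x ∈ Icc (S.node k) (S.node (k + 1)), u x = 0 := by
  have hδ' : (δ : ℂ) ≠ 0 := by exact_mod_cast hδ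
  have hleft : ∀ k, ∃ d : ℂ, HasDerivWithinAt u d (Iio (S.node k)) (S.node k) ∧
      HasDerivWithinAt u (δ * d) (Ioi (S.node k)) (S.node k) :=
    fun k => hu.left_jump (k / N) (cellIndex N k)
  have hright : ∀ k, ∃ d : ℂ,
      HasDerivWithinAt u d (Ioi (S.node k + S.len)) (S.node k + S.len) ∧
      HasDerivWithinAt u (δ * d) (Iio (S.node k + S.len)) (S.node k + S.len) :=
    fun k => hu.right_jump (k / N) (cellIndex N k)
  choose d hd1 hd2 using hleft
  choose e he1 he2 using hright
  have hres : ∀ k, _ := fun k => eq_linSol_of_hasDerivWithinAt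
    (lt_add_of_pos_right (S.node k) S.len_pos) hu.continuous.continuousOn
    (fun x hx => hu.inside x (S.mem_resonators_iff.2 ⟨k, hx⟩)) (hd2 k) (he2 k)
  have hlt : ∀ k, S.node k + S.len < S.node (k + 1) := fun k => by
    rw [node_succ]; linarith [S.gapAt_pos k]
  have hgap : ∀ k, _ := fun k => eq_linSol_of_hasDerivWithinAt (g := 0) (κ := (ω / S.v) ^ 2)
    (hlt k) hu.continuous.continuousOn
    (fun x hx => by simpa using hu.outside x (S.mem_background_iff.2 ⟨k, hx⟩)) (he1 k) (hd1 (k + 1))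
  have hmid : ∀ k, ![u (S.node k + S.len), e k] =
      (S.resonatorMatrix 1 (ω ^ 2 / δ) δ (ω ^ 2)).mulVec ![u (S.node k), d k] := by
    intro k
    rw [S.resonatorMatrix_mulVec hδ ω (S.node k)]
    have h1 := (hres k).1 _ (right_mem_Icc.2 (lt_add_of_pos_right (S.node k) S.len_pos).le)
    have h2 := (hres k).2
    ext i
    fin_cases i
    · simpa using h1
    · simp only [Fin.mk_one, Matrix.cons_val_one, Matrix.cons_val_zero, Matrix.cons_val_fin_one]
      rw [eq_div_iff hδ', mul_comm]
      exact h2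
  refine ⟨fun k => ![u (S.node k), d k], ?_, ?_, ?_⟩
  · intro k
    have h1 : u (S.node (k + N)) = S.phase α * u (S.node k) := by
      rw [node_add_card]; exact hu.quasiperiodic _
    have h2 : d (k + N) = S.phase α * d k := by
      have h3 := hd1 (k + N)
      rw [node_add_card] at h3
      -- The derivative inherits the phase, by uniqueness of the one-sided derivative of the
      -- translate of `u`.
      have h4 : HasDerivWithinAt (fun x => u (x + S.period)) (d (k + N)) (Iio (S.node k))
          (S.node k) := by
        have := HasDerivWithinAt.scomp (S.node k) (t' := Iio (S.node k + S.period)) h3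
          ((hasDerivAt_id (S.node k)).add_const S.period).hasDerivWithinAt
          (s := Iio (S.node k)) (fun x hx => by simpa using hx)
        simpa [Function.comp_def] using this
      have h5 : HasDerivWithinAt (fun x => u (x + S.period)) (S.phase α * d k) (Iio (S.node k))
          (S.node k) := by
        have h6 : (fun x => u (x + S.period)) = fun x => S.phase α * u x := funext hu.quasiperiodic
        rw [h6]
        exact (hd1 k).const_mul _
      exact (uniqueDiffWithinAt_Iio _).eq_deriv _ h4 h5
    ext i
    fin_cases i <;> simp [h1, h2]
  · intro k
    rw [cellMatrix, ← Matrix.mulVec_mulVec, ← hmid,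
      S.gapMatrix_mulVec (S.gapAt k) ω (S.node k + S.len), ← node_succ]
    have h1 := (hgap k).1 _ (right_mem_Icc.2 (hlt k).le)
    have h2 := (hgap k).2
    ext i
    fin_cases i
    · simpa using h1
    · simpa using h2
  · intro k hk x hx
    have hm := hmid k
    have hk0 : u (S.node k) = 0 := congrFun hk 0
    have hk1 : d k = 0 := congrFun hk 1
    simp only at hk
    rw [hk, Matrix.mulVec_zero] at hm
    have hm0 : u (S.node k + S.len) = 0 := congrFun hm 0
    have hm1 : e k = 0 := congrFun hm 1
    rcases le_total x (S.node k + S.len) with h | h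
    · rw [(hres k).1 x ⟨hx.1, h⟩, hk0, hk1]
      simp [linSol]
    · rw [(hgap k).1 x ⟨h, hx.2⟩, hm0, hm1]
      simp [linSol]

lemma charFun_eq_zero_of_isResonance {α δ : ℝ} {ω : ℂ} (hδ : δ ≠ 0) (h : S.IsResonance α δ ω) :
    S.charFun α (ω ^ 2 / δ) δ = 0 := by
  have hδ' : (δ : ℂ) ≠ 0 := by exact_mod_cast hδ
  obtain ⟨u, hu0, hu⟩ := h
  obtain ⟨X, hper, hstep, hzero⟩ := hu.exists_states hδ
  have hchain : ∀ n : ℕ, X n = (S.chainMatrix n 1 (ω ^ 2 / δ) δ (ω ^ 2)).mulVec (X 0) := fun n =>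
    S.eq_chainMatrix_mulVec (m := n) (fun n _ => hstep n) n le_rfl
  rw [charFun_eq_zero_iff, div_mul_cancel₀ _ hδ']
  refine ⟨X 0, fun h0 => hu0 ?_, ?_⟩
  -- A zero state at 0 spreads to all non-negative indices by the transfer matrices. Any other index
  -- is first moved there by |k| cells, which only multiplies its state by a power of the phase.
  · have hX : ∀ k, X k = 0 := by
      intro k
      have hshift : ∀ m : ℕ, X (k + m * N) = S.phase α ^ m • X k := by
        intro m
        induction m with
        | zero => simp
        | succ m ih =>
          have e : k + ((m + 1 : ℕ) : ℤ) * N = k + m * N + N := by push_cast; ring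
          rw [e, hper, ih, smul_smul, pow_succ']
      have hN : (1 : ℤ) ≤ N := by exact_mod_cast NeZero.pos N
      have hpos : 0 ≤ k + (k.natAbs : ℤ) * N := by
        have : (k.natAbs : ℤ) * 1 ≤ k.natAbs * N := by gcongr
        omega
      have h1 := hshift k.natAbs
      lift k + (k.natAbs : ℤ) * N to ℕ using hpos with n
      rw [hchain, h0, Matrix.mulVec_zero] at h1
      exact (smul_eq_zero.1 h1.symm).resolve_left (pow_ne_zero _ (S.phase_ne_zero α))
    funext x
    obtain ⟨k, h1, h2⟩ := S.exists_node_le_lt x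
    exact hzero k (hX k) x ⟨h1, h2.le⟩
  · rw [← hchain N]
    simpa using hper 0

/-- Gluing of the solutions in the cells to a solution on the real line. -/
lemma isResonance_of_states {α δ : ℝ} {ω : ℂ} (hδ : δ ≠ 0) {X : ℤ → Fin 2 → ℂ}
    (hper : ∀ k, X (k + N) = S.phase α • X k)
    (hstep : ∀ k, X (k + 1) = (S.cellMatrix (S.gapAt k) 1 (ω ^ 2 / δ) δ (ω ^ 2)).mulVec (X k))
    (h0 : X 0 ≠ 0) : S.IsResonance α δ ω := by
  have hδ' : (δ : ℂ) ≠ 0 := by exact_mod_cast hδ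
  let Y : ℤ → Fin 2 → ℂ := fun k => (S.resonatorMatrix 1 (ω ^ 2 / δ) δ (ω ^ 2)).mulVec (X k)
  let r : ℤ → ℝ → ℂ := fun k => linSol S.gauge ((ω / S.vb) ^ 2) (S.node k) (X k 0) (δ * X k 1)
  let g : ℤ → ℝ → ℂ := fun k => linSol 0 ((ω / S.v) ^ 2) (S.node k + S.len) (Y k 0) (Y k 1)
  have hY : ∀ k, Y k = ![r k (S.node k + S.len), linSol S.gauge ((ω / S.vb) ^ 2) (S.node k)
      (δ * X k 1) (-((ω / S.vb) ^ 2) * X k 0 - S.gauge * (δ * X k 1)) (S.node k + S.len) / δ] :=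
    fun k => S.resonatorMatrix_mulVec hδ ω (S.node k) (X k)
  have hX : ∀ k, X (k + 1) = ![g k (S.node (k + 1)), linSol 0 ((ω / S.v) ^ 2) (S.node k + S.len)
      (Y k 1) (-((ω / S.v) ^ 2) * Y k 0 - 0 * Y k 1) (S.node (k + 1))] := by
    intro k
    rw [hstep, cellMatrix, ← Matrix.mulVec_mulVec,
      S.gapMatrix_mulVec (S.gapAt k) ω (S.node k + S.len), ← node_succ]
  have hlt : ∀ k, S.node k + S.len < S.node (k + 1) := fun k => by
    rw [node_succ]; linarith [S.gapAt_pos k]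
  have hlt' : ∀ k, S.node k < S.node k + S.len := fun k => lt_add_of_pos_right _ S.len_pos
  choose K hK using S.exists_node_le_lt
  let u : ℝ → ℂ := fun x => if x ≤ S.node (K x) + S.len then r (K x) x else g (K x) x
  have hur : ∀ k, ∀ x ∈ Icc (S.node k) (S.node k + S.len), u x = r k x := by
    intro k x hx
    have : K x = k := S.eq_of_mem_Ico_node (hK x) ⟨hx.1, hx.2.trans_lt (hlt k)⟩
    simp only [u, this]
    rw [if_pos hx.2]
  -- At both ends of the gap `u` is defined by a resonator formula; the two formulas agree there
  -- because of `hY` and `hX`.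
  have hug : ∀ k, ∀ x ∈ Icc (S.node k + S.len) (S.node (k + 1)), u x = g k x := by
    intro k x hx
    rcases hx.1.eq_or_lt with rfl | h1
    · rw [hur k _ ⟨(hlt' k).le, le_rfl⟩]
      simp only [g, linSol_self]
      rw [hY]
      rfl
    rcases hx.2.eq_or_lt with rfl | h2
    · rw [hur (k + 1) _ ⟨le_rfl, (hlt' _).le⟩]
      simp only [r, linSol_self]
      rw [hX]
      rfl
    · have : K x = k := S.eq_of_mem_Ico_node (hK x) ⟨(hlt' k).le.trans hx.1, h2⟩
      simp only [u, this]
      rw [if_neg (not_le.2 h1)]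
  have hinside : ∀ k, ∀ x ∈ Ioo (S.node k) (S.node k + S.len), u =ᶠ[𝓝 x] r k := by
    intro k x hx
    filter_upwards [Ioo_mem_nhds hx.1 hx.2] with t ht using hur k t (Ioo_subset_Icc_self ht)
  have houtside : ∀ k, ∀ x ∈ Ioo (S.node k + S.len) (S.node (k + 1)), u =ᶠ[𝓝 x] g k := by
    intro k x hx
    filter_upwards [Ioo_mem_nhds hx.1 hx.2] with t ht using hug k t (Ioo_subset_Icc_self ht)
  have hleft : ∀ k, HasDerivWithinAt u (X k 1) (Iio (S.node k)) (S.node k) ∧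
      HasDerivWithinAt u (δ * X k 1) (Ioi (S.node k)) (S.node k) := by
    intro k
    constructor
    · obtain ⟨j, rfl⟩ : ∃ j, j + 1 = k := ⟨k - 1, by ring⟩
      have h1 := (hasDerivAt_linSol 0 ((ω / S.v) ^ 2) (S.node j + S.len) (Y j 0) (Y j 1)
        (S.node (j + 1))).hasDerivWithinAt (s := Iio (S.node (j + 1)))
      refine (h1.congr_of_eventuallyEq ?_
        (hug j _ ⟨(hlt j).le, le_rfl⟩)).congr_deriv (by rw [hX]; rfl)
      filter_upwards [Ico_mem_nhdsLT (hlt j)] with t ht using hug j t (Ico_subset_Icc_self ht)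
    · have h1 := (hasDerivAt_linSol S.gauge ((ω / S.vb) ^ 2) (S.node k) (X k 0) (δ * X k 1)
        (S.node k)).hasDerivWithinAt (s := Ioi (S.node k))
      refine (h1.congr_of_eventuallyEq ?_
        (hur k _ ⟨le_rfl, (hlt' k).le⟩)).congr_deriv (by rw [linSol_self])
      filter_upwards [Ioc_mem_nhdsGT (hlt' k)] with t ht using hur k t (Ioc_subset_Icc_self ht)
  have hright : ∀ k, HasDerivWithinAt u (Y k 1) (Ioi (S.node k + S.len)) (S.node k + S.len) ∧
      HasDerivWithinAt u (δ * Y k 1) (Iio (S.node k + S.len)) (S.node k + S.len) := by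
    intro k
    constructor
    · have h1 := (hasDerivAt_linSol 0 ((ω / S.v) ^ 2) (S.node k + S.len) (Y k 0) (Y k 1)
        (S.node k + S.len)).hasDerivWithinAt (s := Ioi (S.node k + S.len))
      refine (h1.congr_of_eventuallyEq ?_
        (hug k _ ⟨le_rfl, (hlt k).le⟩)).congr_deriv (by rw [linSol_self])
      filter_upwards [Ioc_mem_nhdsGT (hlt k)] with t ht using hug k t (Ioc_subset_Icc_self ht)
    · have h1 := (hasDerivAt_linSol S.gauge ((ω / S.vb) ^ 2) (S.node k) (X k 0) (δ * X k 1)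
        (S.node k + S.len)).hasDerivWithinAt (s := Iio (S.node k + S.len))
      refine (h1.congr_of_eventuallyEq ?_
        (hur k _ ⟨(hlt' k).le, le_rfl⟩)).congr_deriv ?_
      · filter_upwards [Ico_mem_nhdsLT (hlt' k)] with t ht using hur k t (Ico_subset_Icc_self ht)
      · have h2 := congrFun (hY k) 1
        simp only [Matrix.cons_val_one, Matrix.cons_val_fin_one] at h2
        rw [h2, mul_div_cancel₀ _ hδ']
  have hI : ∀ k, ∀ x ∈ Ioo (S.node k) (S.node k + S.len), _ := fun k x hx =>
    linSol_ode_of_eventuallyEq (hinside k x hx)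
  have hO : ∀ k, ∀ x ∈ Ioo (S.node k + S.len) (S.node (k + 1)), _ := fun k x hx =>
    linSol_ode_of_eventuallyEq (houtside k x hx)
  refine ⟨u, ?_, ⟨?_, ?_, ?_, ?_, ?_, ?_⟩⟩
  · intro hu
    apply h0
    have h1 := hur 0 (S.node 0) ⟨le_rfl, (hlt' 0).le⟩
    have h2 := (hleft 0).1
    rw [hu] at h1 h2
    have h3 : X 0 1 = 0 := (uniqueDiffWithinAt_Iio _).eq_deriv _ h2 (hasDerivWithinAt_const _ _ 0)
    have h4 : X 0 0 = 0 := by simpa [r] using h1.symm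
    ext i
    fin_cases i
    · exact h4
    · exact h3
  · rw [continuous_iff_continuousAt]
    intro x
    obtain ⟨k, h1, h2⟩ := S.exists_node_le_lt x
    rcases h1.eq_or_lt with rfl | h1
    · exact continuousAt_iff_continuous_left'_right'.2
        ⟨(hleft k).1.continuousWithinAt, (hleft k).2.continuousWithinAt⟩
    rcases lt_trichotomy x (S.node k + S.len) with h | rfl | h
    · exact (hI k x ⟨h1, h⟩).1.continuousAt
    · exact continuousAt_iff_continuous_left'_right'.2
        ⟨(hright k).2.continuousWithinAt, (hright k).1.continuousWithinAt⟩
    · exact (hO k x ⟨h, h2⟩).1.continuousAt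
  · intro x hx
    obtain ⟨k, hk⟩ := S.mem_resonators_iff.1 hx
    exact hI k x hk
  · intro x hx
    obtain ⟨k, hk⟩ := S.mem_background_iff.1 hx
    simpa using hO k x hk
  · intro m i
    rw [leftEnd_eq_node]
    exact ⟨_, hleft _⟩
  · intro m i
    rw [rightEnd, leftEnd_eq_node]
    exact ⟨_, hright _⟩
  · intro x
    obtain ⟨k, h1, h2⟩ := S.exists_node_le_lt x
    have e1 := S.node_add_card k
    have e2 : S.node (k + N + 1) = S.node (k + 1) + S.period := by
      rw [← node_add_card]; congr 1; ring
    change _ = S.phase α * u x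
    have hYper : Y (k + N) = S.phase α • Y k := by
      simp only [Y, hper, Matrix.mulVec_smul]
    rcases le_total x (S.node k + S.len) with h | h
    · rw [hur k x ⟨h1, h⟩, hur (k + N) (x + S.period) ⟨by linarith, by linarith⟩]
      simp only [r, hper, Pi.smul_apply, smul_eq_mul, e1]
      rw [mul_left_comm, linSol_mul, linSol_add]
    · rw [hug k x ⟨h, h2.le⟩, hug (k + N) (x + S.period) ⟨by linarith, by linarith⟩]
      simp only [g, hYper, Pi.smul_apply, smul_eq_mul, e1]
      rw [linSol_mul, add_right_comm, linSol_add]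

lemma isResonance_iff {α δ : ℝ} {ω : ℂ} (hδ : δ ≠ 0) :
    S.IsResonance α δ ω ↔ S.charFun α (ω ^ 2 / δ) δ = 0 := by
  refine ⟨charFun_eq_zero_of_isResonance hδ, fun h => ?_⟩
  have hδ' : (δ : ℂ) ≠ 0 := by exact_mod_cast hδ
  rw [charFun_eq_zero_iff, div_mul_cancel₀ _ hδ'] at h
  obtain ⟨V, hV, hM⟩ := h
  have hN := NeZero.pos N
  have hN' : (N : ℤ) ≠ 0 := by omega
  let X : ℤ → Fin 2 → ℂ := fun k => S.phase α ^ (k / N) •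
    (S.chainMatrix (cellIndex N k) 1 (ω ^ 2 / δ) δ (ω ^ 2)).mulVec V
  refine isResonance_of_states hδ (X := X) ?_ ?_ ?_
  · intro k
    simp only [X]
    rw [cellIndex_add_card, Int.add_ediv_of_dvd_right (dvd_refl _), Int.ediv_self hN',
      zpow_add₀ (S.phase_ne_zero α), zpow_one, mul_comm, smul_smul]
  · intro k
    obtain ⟨m, i, rfl⟩ : ∃ (m : ℤ) (i : Fin N), m * N + i = k :=
      ⟨_, _, ediv_mul_add_cellIndex k⟩
    have hi := i.2
    have hgi : S.gapAt (m * N + i) = S.gapAt (i : ℕ) := by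
      rw [← gap_eq_gapAt, gapAt, cellIndex_natCast]
    have hXi : (S.cellMatrix (S.gapAt (m * N + i)) 1 (ω ^ 2 / δ) δ (ω ^ 2)).mulVec
        (X (m * N + i)) = S.phase α ^ m •
          (S.chainMatrix (i + 1) 1 (ω ^ 2 / δ) δ (ω ^ 2)).mulVec V := by
      simp only [X]
      rw [mul_add_ediv, cellIndex_mul_add, Matrix.mulVec_smul, Matrix.mulVec_mulVec, hgi]
      rfl
    rw [hXi]
    by_cases h : (i : ℕ) + 1 < N
    · have e : m * N + i + 1 = m * N + ((⟨i + 1, h⟩ : Fin N) : ℕ) := by push_cast; ring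
      simp only [X]
      rw [e, mul_add_ediv, cellIndex_mul_add]
    -- After the last resonator of a cell, the eigenvector equation `hM` replaces the full product
    -- by the phase.
    · have e : m * N + i + 1 = (m + 1) * N + ((0 : Fin N) : ℕ) := by
        have : ((i : ℕ) : ℤ) + 1 = N := by omega
        simp
        linear_combination this
      simp only [X]
      rw [e, mul_add_ediv, cellIndex_mul_add, show (i : ℕ) + 1 = N by omega, hM, smul_smul,
        zpow_add₀ (S.phase_ne_zero α), zpow_one]
      simp [chainMatrix]
  · have : cellIndex N 0 = 0 := by
      have := cellIndex_natCast (0 : Fin N)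
      simpa using this
    have hX0 : X 0 = V := by
      ext i
      fin_cases i <;> simp [X, this, chainMatrix]
    rwa [hX0]

end PeriodicChain

/-! ### The principal square root. -/

section PrincipalSqrt

@[simp] lemma principalSqrt_zero : principalSqrt 0 = 0 := by simp [principalSqrt]

lemma principalSqrt_sq (z : ℂ) : principalSqrt z ^ 2 = z := by
  have h := Complex.cpow_nat_inv_pow z two_ne_zero
  rwa [show ((2 : ℕ) : ℂ)⁻¹ = 1 / 2 by norm_num] at h

lemma re_principalSqrt {z : ℂ} (hz : z ≠ 0) :
    (principalSqrt z).re = Real.exp (Real.log ‖z‖ / 2) * Real.cos (z.arg / 2) := by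
  rw [principalSqrt, Complex.cpow_def_of_ne_zero hz, Complex.exp_re]
  have h : Complex.log z * (1 / 2) = ((1 / 2 : ℝ) : ℂ) * Complex.log z := by push_cast; ring
  rw [h, Complex.re_ofReal_mul, Complex.im_ofReal_mul, Complex.log_re, Complex.log_im]
  ring_nf

lemma re_principalSqrt_nonneg (z : ℂ) : 0 ≤ (principalSqrt z).re := by
  rcases eq_or_ne z 0 with rfl | hz
  · simp
  rw [re_principalSqrt hz]
  have h1 := Complex.neg_pi_lt_arg z
  have h2 := Complex.arg_le_pi z
  exact mul_nonneg (Real.exp_pos _).le (Real.cos_nonneg_of_mem_Icc ⟨by linarith, by linarith⟩)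

lemma re_principalSqrt_pos {z : ℂ} (hz : z ∈ Complex.slitPlane) : 0 < (principalSqrt z).re := by
  obtain ⟨h0, hz⟩ := Complex.mem_slitPlane_iff_arg.1 hz
  rw [re_principalSqrt hz]
  have h1 := Complex.neg_pi_lt_arg z
  have h2 := (Complex.arg_le_pi z).lt_of_ne h0
  exact mul_pos (Real.exp_pos _) (Real.cos_pos_of_mem_Ioo ⟨by linarith, by linarith⟩)

lemma principalSqrt_ofReal_mul {r : ℝ} (hr : 0 < r) (z : ℂ) :
    principalSqrt (r * z) = (√r : ℝ) * principalSqrt z := by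
  rcases eq_or_ne z 0 with rfl | hz
  · simp
  have hr' : (r : ℂ) ≠ 0 := by exact_mod_cast hr.ne'
  rw [principalSqrt, principalSqrt, Complex.cpow_def_of_ne_zero (mul_ne_zero hr' hz),
    Complex.cpow_def_of_ne_zero hz, Complex.log_ofReal_mul hr hz, add_mul, Complex.exp_add]
  congr 1
  rw [Real.sqrt_eq_rpow, Real.rpow_def_of_pos hr]
  push_cast
  rfl

lemma eq_principalSqrt {w z : ℂ} (hw : 0 ≤ w.re) (hwz : w ^ 2 = z)
    (hz : z = 0 ∨ z ∈ Complex.slitPlane) : w = principalSqrt z := by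
  rcases hz with rfl | hz
  · simpa using hwz
  rcases sq_eq_sq_iff_eq_or_eq_neg.1 (hwz.trans (principalSqrt_sq z).symm) with h | h
  · exact h
  · have := re_principalSqrt_pos hz
    rw [h, Complex.neg_re] at hw
    linarith

end PrincipalSqrt

/-! ### Zeros of the characteristic function for small contrast. -/

/-- Implicit function theorem at a simple zero of a function of two complex variables. -/
lemma exists_implicit_branch {f : ℂ × ℂ → ℂ} (hf : ContDiff ℂ 1 f) {ζ₀ d : ℂ} (h0 : f (0, ζ₀) = 0)
    (hd : HasDerivAt (fun ζ => f (0, ζ)) d ζ₀) (hd0 : d ≠ 0) :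
    ∃ ψ : ℂ → ℂ, DifferentiableAt ℂ ψ 0 ∧ ψ 0 = ζ₀ ∧
      ∀ᶠ p : ℂ × ℂ in 𝓝 (0, ζ₀), f p = 0 ↔ ψ p.1 = p.2 := by
  have hs := hf.contDiffAt.hasStrictFDerivAt (x := (0, ζ₀)) one_ne_zero
  have h1 : HasDerivAt (fun ζ => f (0, ζ)) (fderiv ℂ f (0, ζ₀) (0, 1)) ζ₀ :=
    hs.hasFDerivAt.comp_hasDerivAt ζ₀ ((hasDerivAt_const ζ₀ (0 : ℂ)).prodMk (hasDerivAt_id ζ₀))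
  have hinv : (fderiv ℂ f (0, ζ₀) ∘L .inr ℂ ℂ ℂ).IsInvertible := by
    refine ⟨ContinuousLinearEquiv.unitsEquivAut ℂ (Units.mk0 d hd0), ?_⟩
    ext
    simp [← h1.unique hd]
  have hiff := hs.eventually_apply_eq_iff_implicitFunctionOfProdDomain hinv
  rw [h0] at hiff
  exact ⟨hs.implicitFunctionOfProdDomain hinv,
    (hs.hasStrictFDerivAt_implicitFunctionOfProdDomain hinv).hasFDerivAt.differentiableAt,
    hiff.self_of_nhds.1 h0, hiff⟩

namespace PeriodicChain

variable {N : ℕ} (S : PeriodicChain N) [NeZero N]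

lemma contDiff_chainMatrix {E : Type*} [NormedAddCommGroup E] [NormedSpace ℂ E]
    {η x y z : E → ℂ} (hη : ContDiff ℂ 1 η) (hx : ContDiff ℂ 1 x) (hy : ContDiff ℂ 1 y)
    (hz : ContDiff ℂ 1 z) (n : ℕ) (i j : Fin 2) :
    ContDiff ℂ 1 (fun e => S.chainMatrix n (η e) (x e) (y e) (z e) i j) := by
  have hmul : ∀ {A B : E → Matrix (Fin 2) (Fin 2) ℂ}, (∀ i j, ContDiff ℂ 1 fun e => A e i j) →
      (∀ i j, ContDiff ℂ 1 fun e => B e i j) → ∀ i j, ContDiff ℂ 1 fun e => (A e * B e) i j := by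
    intro A B hA hB i j
    simp only [Matrix.mul_apply]
    exact ContDiff.sum fun k _ => (hA i k).mul (hB k j)
  have hc : ∀ (g v : ℂ) (t : ℝ), ContDiff ℂ 1 fun e => cosSol g (z e / v ^ 2) t := fun g v t =>
    (contDiff_cosSol g t).comp (hz.div_const _)
  have hs : ∀ (g v : ℂ) (t : ℝ), ContDiff ℂ 1 fun e => sinSol g (z e / v ^ 2) t := fun g v t =>
    (contDiff_sinSol g t).comp (hz.div_const _)
  have hgap : ∀ s i j, ContDiff ℂ 1 fun e => S.gapMatrix s (z e) i j := by
    intro s i j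
    have h1 := hc 0 S.v s
    have h2 := hs 0 S.v s
    fin_cases i <;> fin_cases j <;> simp only [gapMatrix, Fin.zero_eta, Fin.mk_one, Matrix.of_apply,
      Matrix.cons_val', Matrix.cons_val_zero, Matrix.cons_val_one, Matrix.cons_val_fin_one] <;>
      fun_prop
  have hres : ∀ i j, ContDiff ℂ 1 fun e => S.resonatorMatrix (η e) (x e) (y e) (z e) i j := by
    intro i j
    have h1 := hc S.gauge S.vb S.len
    have h2 := hs S.gauge S.vb S.len
    fin_cases i <;> fin_cases j <;> simp only [resonatorMatrix, Fin.zero_eta, Fin.mk_one,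
      Matrix.of_apply, Matrix.cons_val', Matrix.cons_val_zero, Matrix.cons_val_one,
      Matrix.cons_val_fin_one] <;> fun_prop
  induction n generalizing i j with
  | zero =>
    simp only [chainMatrix]
    exact contDiff_const
  | succ n ih => exact hmul (hmul (hgap _) hres) ih i j

lemma contDiff_charFun (α : ℝ) : ContDiff ℂ 1 fun p : ℂ × ℂ => S.charFun α p.2 p.1 := by
  simp only [charFun, Matrix.trace_fin_two]
  have h := S.contDiff_chainMatrix (η := fun _ : ℂ × ℂ => 1) (x := fun p => p.2)
    (y := fun p => p.1) (z := fun p => p.2 * p.1) (by fun_prop) (by fun_prop) (by fun_prop)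
    (by fun_prop) N
  have h1 := h 0 0
  have h2 := h 1 1
  fun_prop

/-- By homogeneity ζ^(-N) `charFun` is the continuous function `G` at (ζ⁻¹, δζ⁻¹, ζδ), and `G 0` is
minus the phase times the non-zero leading trace. The condition on ζδ = ω² keeps the third argument
small. -/
lemma charFun_ne_zero_of_large (α : ℝ) : ∃ ε > 0, ∀ ζ δ : ℂ, ε⁻¹ < ‖ζ‖ → ‖δ‖ < ε → ‖δ‖ < 1 →
    ‖ζ * δ‖ < ε → S.charFun α ζ δ ≠ 0 := by
  let G : ℂ × ℂ × ℂ → ℂ := fun p => p.1 ^ N * S.phase α ^ 2 -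
    S.phase α * (S.chainMatrix N p.1 1 p.2.1 p.2.2).trace + p.1 ^ N * S.decay ^ N
  have hG : ContDiff ℂ 1 G := by
    simp only [G, Matrix.trace_fin_two]
    have h := S.contDiff_chainMatrix (η := fun p : ℂ × ℂ × ℂ => p.1) (x := fun p => 1)
      (y := fun p => p.2.1) (z := fun p => p.2.2) (by fun_prop) (by fun_prop) (by fun_prop)
      (by fun_prop) N
    have h1 := h 0 0
    have h2 := h 1 1
    fun_prop
  have hG0 : G 0 ≠ 0 := by
    simp [G, NeZero.ne N, S.phase_ne_zero α, S.trace_chainMatrix_leading_ne_zero]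
  obtain ⟨ε, hε, hball⟩ := Metric.eventually_nhds_iff.1
    (hG.continuous.continuousAt.eventually_ne hG0)
  refine ⟨ε, hε, fun ζ δ h1 h2 h3 h4 h5 => ?_⟩
  have hζ : ζ ≠ 0 := norm_pos_iff.1 ((inv_pos.2 hε).trans h1)
  have hζ' : ‖ζ⁻¹‖ < ε := by
    rw [norm_inv]
    exact inv_lt_of_inv_lt₀ hε h1
  refine hball (y := (ζ⁻¹, δ * ζ⁻¹, ζ * δ)) ?_ ?_
  · rw [dist_zero_right]
    refine max_lt hζ' (max_lt ?_ h4)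
    simp only [norm_mul]
    exact (mul_le_of_le_one_left (norm_nonneg _) h3.le).trans_lt hζ'
  · have h := S.chainMatrix_smul N ζ ζ⁻¹ 1 (δ * ζ⁻¹) (ζ * δ)
    rw [mul_inv_cancel₀ hζ, mul_one, mul_left_comm, mul_inv_cancel₀ hζ, mul_one] at h
    rw [charFun, h, Matrix.trace_smul, smul_eq_mul] at h5
    have h6 : ζ ^ N * G (ζ⁻¹, δ * ζ⁻¹, ζ * δ) = 0 := by
      have h7 : ζ ^ N * ζ⁻¹ ^ N = 1 := by rw [← mul_pow, mul_inv_cancel₀ hζ, one_pow]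
      simp only [G]
      linear_combination h5 + (S.phase α ^ 2 + S.decay ^ N) * h7
    exact (mul_eq_zero.1 h6).resolve_left (pow_ne_zero _ hζ)

/-- Simplicity of the eigenvalues of the capacitance matrix gives `N` of them. -/
lemma exists_enum_eigenvalues {α : ℝ} (h : S.HasSimpleEigenvalues α) : ∃ lam : Fin N → ℂ,
    Function.Injective lam ∧ Set.range lam = S.capacitanceEigenvalues α := by
  classical
  set p := (S.qpCapacitance α).charpoly with hp
  have hp0 : p ≠ 0 := (Matrix.charpoly_monic _).ne_zero
  have hcard : p.roots.toFinset.card = N := by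
    have hnodup : p.roots.Nodup := Multiset.nodup_iff_count_le_one.2 fun μ => by
      rw [Polynomial.count_roots]; exact h μ
    rw [Multiset.toFinset_card_of_nodup hnodup,
      ← (IsAlgClosed.splits p).natDegree_eq_card_roots, hp, Matrix.charpoly_natDegree_eq_dim,
      Fintype.card_fin]
  have hl := S.len_ne_zero'
  let e := (Finset.equivFinOfCardEq hcard).symm
  refine ⟨fun i => (e i : ℂ) / S.len, fun i j hij => ?_, ?_⟩
  · exact e.injective (Subtype.ext ((div_left_inj' hl).1 hij))
  · ext μ
    have h1 : μ ∈ S.capacitanceEigenvalues α ↔ μ * S.len ∈ p.roots.toFinset := by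
      rw [Multiset.mem_toFinset, Polynomial.mem_roots hp0, Polynomial.IsRoot, hp,
        Matrix.eval_charpoly, ← Matrix.exists_mulVec_eq_zero_iff]
      refine exists_congr fun a => and_congr_right fun _ => ?_
      rw [Matrix.sub_mulVec, sub_eq_zero, eq_comm]
      have : μ • S.volumeMatrix.mulVec a =
          ((Matrix.scalar (Fin N)) (μ * S.len)).mulVec a := by
        ext i
        simp [volumeMatrix, Matrix.mulVec_diagonal, mul_assoc]
      rw [this]
    rw [h1]
    constructor
    · rintro ⟨i, rfl⟩
      rw [div_mul_cancel₀ _ hl]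
      exact (e i).2
    · intro hμ
      refine ⟨e.symm ⟨_, hμ⟩, ?_⟩
      simp [hl]

/-- Counting: a non-zero polynomial of degree at most `N` with `N` known distinct roots has no
others, and all are simple. No comparison with the characteristic polynomial of the matrix is
needed. -/
lemma simple_zeros_charFun {α : ℝ} {lam : Fin N → ℂ} (hinj : Function.Injective lam)
    (hran : Set.range lam = S.capacitanceEigenvalues α) :
    (∀ i, ∃ d ≠ 0, HasDerivAt (fun ζ => S.charFun α ζ 0) d (S.vb ^ 2 * lam i)) ∧
      ∀ ζ, S.charFun α ζ 0 = 0 → ∃ i, ζ = S.vb ^ 2 * lam i := by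
  classical
  obtain ⟨p, hp0, hdeg, heval⟩ := S.exists_polynomial_charFun α
  have hv : (S.vb : ℂ) ^ 2 ≠ 0 := pow_ne_zero _ S.vb_ne_zero'
  have hroot : ∀ i, p.IsRoot (S.vb ^ 2 * lam i) := fun i => by
    rw [Polynomial.IsRoot, heval]
    exact S.charFun_eq_zero_of_eigenvalue (hran ▸ Set.mem_range_self i)
  let T : Finset ℂ := Finset.univ.image fun i => (S.vb : ℂ) ^ 2 * lam i
  have hTcard : T.card = N := by
    rw [Finset.card_image_of_injective _ fun i j h => hinj (mul_left_cancel₀ hv h),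
      Finset.card_univ, Fintype.card_fin]
  have hsub : T ⊆ p.roots.toFinset := by
    intro ζ hζ
    obtain ⟨i, -, rfl⟩ := Finset.mem_image.1 hζ
    exact Multiset.mem_toFinset.2 ((Polynomial.mem_roots hp0).2 (hroot i))
  have hle : p.roots.card ≤ N := (Polynomial.card_roots' p).trans hdeg
  have hle' := Multiset.toFinset_card_le p.roots
  have hge := Finset.card_le_card hsub
  have hT : T = p.roots.toFinset := Finset.eq_of_subset_of_card_le hsub (by omega)
  have hnodup : p.roots.Nodup := Multiset.toFinset_card_eq_card_iff_nodup.1 (by omega)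
  have hfun : (fun ζ => S.charFun α ζ 0) = fun ζ => p.eval ζ := funext fun ζ => (heval ζ).symm
  constructor
  · intro i
    refine ⟨p.derivative.eval (S.vb ^ 2 * lam i), fun h => ?_, hfun ▸ p.hasDerivAt _⟩
    have h1 := (Polynomial.one_lt_rootMultiplicity_iff_isRoot hp0).2 ⟨hroot i, h⟩
    rw [← Polynomial.count_roots] at h1
    exact absurd (Multiset.nodup_iff_count_le_one.1 hnodup _) (not_le.2 h1)
  · intro ζ hζ
    have : ζ ∈ T := by
      rw [hT, Multiset.mem_toFinset, Polynomial.mem_roots hp0, Polynomial.IsRoot, heval, hζ]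
    obtain ⟨i, -, rfl⟩ := Finset.mem_image.1 this
    exact ⟨i, rfl⟩

/-- The zeros of the characteristic function for small contrast. -/
lemma exists_branches {α : ℝ} {lam : Fin N → ℂ} (hinj : Function.Injective lam)
    (hran : Set.range lam = S.capacitanceEigenvalues α) :
    ∃ ψ : Fin N → ℂ → ℂ, (∀ i, DifferentiableAt ℂ (ψ i) 0) ∧
      (∀ i, ψ i 0 = S.vb ^ 2 * lam i) ∧
      (∀ i, ∀ᶠ δ in 𝓝 (0 : ℂ), S.charFun α (ψ i δ) δ = 0) ∧
      (∀ i, lam i = 0 → ∀ᶠ δ in 𝓝 (0 : ℂ), ψ i δ = 0) ∧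
      ∃ ε > 0, ∀ᶠ δ in 𝓝 (0 : ℂ), ∀ ζ, ‖ζ * δ‖ < ε → S.charFun α ζ δ = 0 → ∃ i, ζ = ψ i δ := by
  obtain ⟨hsimple, hall⟩ := S.simple_zeros_charFun hinj hran
  have hzero : ∀ i, S.charFun α (S.vb ^ 2 * lam i) 0 = 0 := fun i =>
    S.charFun_eq_zero_of_eigenvalue (hran ▸ Set.mem_range_self i)
  choose d hd0 hd using hsimple
  choose ψ hψ1 hψ2 hψ3 using fun i => exists_implicit_branch (S.contDiff_charFun α)
    (hzero i) (hd i) (hd0 i)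
  have hcont : ∀ i, Tendsto (fun δ => (δ, ψ i δ)) (𝓝 0) (𝓝 (0, S.vb ^ 2 * lam i)) := fun i => by
    rw [← hψ2 i]
    exact (continuousAt_id.prodMk (hψ1 i).continuousAt)
  refine ⟨ψ, hψ1, hψ2, fun i => ?_, fun i hi => ?_, ?_⟩
  · filter_upwards [(hcont i).eventually (hψ3 i)] with δ h using h.2 rfl
  · have hz := hzero i
    have h := hψ3 i
    rw [hi, mul_zero] at hz h
    have ht : Tendsto (fun δ : ℂ => (δ, (0 : ℂ))) (𝓝 0) (𝓝 (0, 0)) :=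
      (continuousAt_id.prodMk continuousAt_const)
    filter_upwards [ht.eventually h] with δ h
    exact h.1 ((S.charFun_zero α δ 0).trans hz)
  · obtain ⟨ε, hε, hlarge⟩ := S.charFun_ne_zero_of_large α
    -- Near each point of the compact disc the zeros either lie on one branch or are absent, so
    -- finitely many neighbourhoods give a uniform bound on δ.
    have hcompact : ∀ᶠ δ in 𝓝 (0 : ℂ), ∀ ζ ∈ Metric.closedBall (0 : ℂ) ε⁻¹,
        S.charFun α ζ δ = 0 → ∃ i, ζ = ψ i δ := by
      refine (isCompact_closedBall (0 : ℂ) ε⁻¹).eventually_forall_of_forall_eventually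
        (P := fun δ ζ => S.charFun α ζ δ = 0 → ∃ i, ζ = ψ i δ) fun ζ _ => ?_
      by_cases h : S.charFun α ζ 0 = 0
      · obtain ⟨i, rfl⟩ := hall ζ h
        filter_upwards [hψ3 i] with p hp h0
        exact ⟨i, (hp.1 h0).symm⟩
      · filter_upwards [((S.contDiff_charFun α).continuous.continuousAt (x := (0, ζ))).eventually_ne
          h] with p hp h0
        exact absurd h0 hp
    refine ⟨ε, hε, ?_⟩
    filter_upwards [hcompact, Metric.ball_mem_nhds (0 : ℂ) hε, Metric.ball_mem_nhds (0 : ℂ) one_pos]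
      with δ h1 h2 h3 ζ h4 h5
    rcases le_or_gt ‖ζ‖ ε⁻¹ with h | h
    · exact h1 ζ (by simpa using h) h5
    · exact absurd h5 (hlarge ζ δ h (by simpa using h2) (by simpa using h3) h4)

end PeriodicChain

/-! ### From branches to eigenfrequencies. -/

lemma tendsto_ofReal_nhdsGT_zero :
    Tendsto (fun δ : ℝ => (δ : ℂ)) (𝓝[>] 0) (𝓝 0) :=
  (Complex.continuous_ofReal.tendsto' 0 0 Complex.ofReal_zero).mono_left nhdsWithin_le_nhds

lemma tendsto_principalSqrt_zero : Tendsto principalSqrt (𝓝 0) (𝓝 0) := by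
  have h : ContinuousAt principalSqrt 0 :=
    Complex.continuousAt_cpow_const_of_re_pos (Or.inl (by simp)) (by norm_num)
  simpa [ContinuousAt] using h

/-- Square roots of a branch with limit in the slit plane have an expansion to first order. -/
lemma isBigO_principalSqrt_branch {ψ : ℂ → ℂ} (hψ : DifferentiableAt ℂ ψ 0)
    (h0 : ψ 0 ∈ Complex.slitPlane) :
    (fun δ : ℝ => principalSqrt (δ * ψ δ) - principalSqrt (δ * ψ 0))
      =O[𝓝[>] 0] fun δ : ℝ => δ := by
  have h1 : DifferentiableAt ℂ (fun δ => principalSqrt (ψ δ)) 0 := hψ.cpow_const h0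
  have h2 := h1.isBigO_sub.comp_tendsto tendsto_ofReal_nhdsGT_zero
  -- The factor √δ comes out of both roots. Bounding it by 1 suffices, although the difference is in
  -- fact of order δ^(3/2).
  have h3 : (fun δ : ℝ => ((√δ : ℝ) : ℂ)) =O[𝓝[>] 0] fun _ : ℝ => (1 : ℂ) := by
    refine IsBigO.of_bound 1 ?_
    filter_upwards [Ioc_mem_nhdsGT (zero_lt_one (α := ℝ))] with δ hδ
    rw [Complex.norm_real, Real.norm_of_nonneg (Real.sqrt_nonneg _), norm_one, mul_one]
    exact Real.sqrt_le_one.2 hδ.2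
  have h4 := h3.mul h2
  have h5 : (fun δ : ℝ => (δ : ℂ)) =O[𝓝[>] 0] fun δ : ℝ => δ :=
    IsBigO.of_norm_left (by simpa using (isBigO_refl (fun δ : ℝ => δ) (𝓝[>] 0)).norm_left)
  refine (h4.congr' ?_ ?_).trans h5
  · filter_upwards [self_mem_nhdsWithin] with δ hδ
    rw [principalSqrt_ofReal_mul hδ, principalSqrt_ofReal_mul hδ]
    simp only [Function.comp_apply]
    ring
  · filter_upwards with δ
    simp

namespace PeriodicChain

variable {N : ℕ} (S : PeriodicChain N) [NeZero N]

lemma subwavelength_eigenfrequencies {α : ℝ} (hsimple : S.HasSimpleEigenvalues α) :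
    ∃ (lam : Fin N → ℂ) (ω : Fin N → ℝ → ℂ),
      Function.Injective lam ∧
      Set.range lam = S.capacitanceEigenvalues α ∧
      (∀ i, S.IsSubwavelength α (ω i)) ∧
      (∀ᶠ δ in 𝓝[>] (0 : ℝ), Function.Injective fun i => ω i δ) ∧
      (∀ w : ℝ → ℂ, S.IsSubwavelength α w → ∀ᶠ δ in 𝓝[>] (0 : ℝ), ∃ i, w δ = ω i δ) ∧
      (∀ i, ∀ δ : ℝ, 0 < δ → lam i ≠ 0 → 0 < (principalSqrt (δ * lam i)).re) ∧
      (∀ i, (fun δ : ℝ => ω i δ - S.vb * principalSqrt (δ * lam i))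
        =O[𝓝[>] 0] fun δ : ℝ => δ) := by
  obtain ⟨lam, hinj, hran⟩ := S.exists_enum_eigenvalues hsimple
  obtain ⟨ψ, hψd, hψ0, hψF, hψz, ε, hε, huniq⟩ := S.exists_branches hinj hran
  have hcast := tendsto_ofReal_nhdsGT_zero
  have hlam : ∀ i, lam i = 0 ∨ 0 < (lam i).re := fun i =>
    S.eigenvalue_eq_zero_or_re_pos (hran ▸ Set.mem_range_self i)
  have hslit : ∀ {r : ℝ} {z : ℂ}, 0 < r → 0 < z.re → (r : ℂ) * z ∈ Complex.slitPlane :=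
    fun hr hz => Or.inl (by rw [Complex.re_ofReal_mul]; exact mul_pos hr hz)
  have hvb : (0 : ℝ) < S.vb ^ 2 := pow_pos S.vb_pos 2
  have hψre : ∀ i, lam i ≠ 0 → 0 < (ψ i 0).re := fun i hi => by
    rw [hψ0, ← Complex.ofReal_pow, Complex.re_ofReal_mul]
    exact mul_pos hvb ((hlam i).resolve_left hi)
  have hψlim : ∀ i, Tendsto (fun δ : ℝ => ψ i δ) (𝓝[>] 0) (𝓝 (ψ i 0)) := fun i =>
    (hψd i).continuousAt.tendsto.comp hcast
  -- Off the negative axis a number has only one square root with non-negative real part; this turns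
  -- uniqueness of ω² into uniqueness of ω.
  have hbranch : ∀ i, ∀ᶠ δ : ℝ in 𝓝[>] 0, ψ i δ = 0 ∨ 0 < (ψ i δ).re := by
    intro i
    by_cases hi : lam i = 0
    · filter_upwards [hcast.eventually (hψz i hi)] with δ h using Or.inl h
    · filter_upwards [(Complex.continuous_re.tendsto _).comp (hψlim i) |>.eventually
        (lt_mem_nhds (hψre i hi))] with δ h using Or.inr h
  refine ⟨lam, fun i δ => principalSqrt (δ * ψ i δ), hinj, hran, fun i => ⟨?_, ?_⟩, ?_, ?_, ?_, ?_⟩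
  · refine tendsto_principalSqrt_zero.comp ?_
    simpa using hcast.mul (hψlim i)
  · filter_upwards [hcast.eventually (hψF i), self_mem_nhdsWithin] with δ h hδ
    refine ⟨re_principalSqrt_nonneg _, ?_⟩
    have hδ0 : δ ≠ 0 := ne_of_gt hδ
    have hδ' : (δ : ℂ) ≠ 0 := by exact_mod_cast hδ0
    rwa [isResonance_iff hδ0, principalSqrt_sq, mul_div_cancel_left₀ _ hδ']
  · have hne : ∀ᶠ δ : ℝ in 𝓝[>] 0, ∀ i j, i ≠ j → ψ i δ ≠ ψ j δ := by
      refine eventually_all.2 fun i => eventually_all.2 fun j => ?_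
      by_cases hij : i = j
      · simp [hij]
      · have h0 : ψ i 0 ≠ ψ j 0 := by
          rw [hψ0, hψ0]
          exact fun h => hij (hinj (mul_left_cancel₀ (pow_ne_zero 2 S.vb_ne_zero') h))
        filter_upwards [((hψlim i).sub (hψlim j)).eventually_ne (sub_ne_zero.2 h0)] with δ h _
          using sub_ne_zero.1 h
    filter_upwards [hne, self_mem_nhdsWithin] with δ h hδ i j hij
    have hδ' : (δ : ℂ) ≠ 0 := by exact_mod_cast (ne_of_gt hδ : δ ≠ 0)
    by_contra hne
    apply h i j hne
    have h2 := congrArg (· ^ 2) hij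
    simp only [principalSqrt_sq] at h2
    exact mul_left_cancel₀ hδ' h2
  · rintro w ⟨hw0, hw⟩
    -- Here ω → 0 enters: it bounds ζδ = ω², while ζ = ω²/δ itself need not be bounded a priori.
    have hsmall : ∀ᶠ δ in 𝓝[>] (0 : ℝ), ‖w δ ^ 2‖ < ε := by
      have h := (hw0.pow 2).norm
      simp only [ne_eq, OfNat.ofNat_ne_zero, not_false_eq_true, zero_pow, norm_zero] at h
      exact h.eventually (gt_mem_nhds hε)
    filter_upwards [hw, hsmall, hcast.eventually huniq, eventually_all.2 hbranch,
      self_mem_nhdsWithin] with δ h1 h2 h3 h4 hδ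
    have hδ0 : δ ≠ 0 := ne_of_gt hδ
    have hδ' : (δ : ℂ) ≠ 0 := by exact_mod_cast hδ0
    obtain ⟨i, hi⟩ := h3 (w δ ^ 2 / δ) (by rwa [div_mul_cancel₀ _ hδ'])
      ((isResonance_iff hδ0).1 h1.2)
    refine ⟨i, eq_principalSqrt h1.1 ?_ ?_⟩
    · rw [← hi, mul_div_cancel₀ _ hδ']
    · rcases h4 i with h | h
      · exact Or.inl (by rw [h, mul_zero])
      · exact Or.inr (hslit hδ h)
  · intro i δ hδ hi
    exact re_principalSqrt_pos (hslit hδ ((hlam i).resolve_left hi))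
  · intro i
    by_cases hi : lam i = 0
    · refine IsBigO.congr' (isBigO_zero _ _) ?_ EventuallyEq.rfl
      filter_upwards [hcast.eventually (hψz i hi)] with δ h
      simp [h, hi]
    · refine (isBigO_principalSqrt_branch (hψd i) (Or.inl (hψre i hi))).congr' ?_ EventuallyEq.rfl
      filter_upwards with δ
      have h1 : S.vb * principalSqrt (δ * lam i) = principalSqrt (δ * ψ i 0) := by
        rw [hψ0, mul_left_comm, ← Complex.ofReal_pow, principalSqrt_ofReal_mul hvb,
          Real.sqrt_sq S.vb_pos.le]
      rw [h1]

end PeriodicChain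

end

theorem mainTheorem5 {N : ℕ} [NeZero N] (S : PeriodicChain N) :
    ∃ (lam : Fin N → ℝ → ℂ) (ω : Fin N → ℝ → ℝ → ℂ),
      ∀ α ∈ S.brillouinZone, S.HasSimpleEigenvalues α →
        -- the `lam i α` are the `N` eigenvalues of `C a = μ V a`
        Function.Injective (fun i => lam i α) ∧
        Set.range (fun i => lam i α) = S.capacitanceEigenvalues α ∧
        -- the `ω i α` are, for small contrast, exactly `N` subwavelength eigenfrequencies
        (∀ i, S.IsSubwavelength α (ω i α)) ∧
        (∀ᶠ δ in 𝓝[>] (0 : ℝ), Function.Injective fun i => ω i α δ) ∧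
        (∀ w : ℝ → ℂ, S.IsSubwavelength α w → ∀ᶠ δ in 𝓝[>] (0 : ℝ), ∃ i, w δ = ω i α δ) ∧
        -- the selected square roots have positive real part, and the expansion holds
        (∀ i, ∀ δ : ℝ, 0 < δ → lam i α ≠ 0 → 0 < (principalSqrt (δ * lam i α)).re) ∧
        (∀ i, (fun δ : ℝ => ω i α δ - S.vb * principalSqrt (δ * lam i α))
          =O[𝓝[>] 0] fun δ : ℝ => δ) := by
  -- The choice is made separately for each α; where the eigenvalues are not simple the values are
  -- arbitrary.
  choose! lam ω h using fun (α : ℝ) (hs : S.HasSimpleEigenvalues α) =>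
    S.subwavelength_eigenfrequencies hs
  exact ⟨fun i α => lam α i, fun i α => ω α i, fun α _ hs => h α hs⟩
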